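/- Let $1\le \ell<r\le h$ be integers. An $r$-graph is a finite vertex set together with a set of $r$-element subsets of it, called edges. For an $r$-graph $G$ on $n\ge\ell$ vertices let $\delta_\ell(G)$ be the minimum, over all $\ell$-sets $L$ of vertices of $G$, of the number of edges of $G$ containing $L$. For an $r$-graph $H$ on $h$ vertices, a copy of $H$ in $G$ is a subgraph of $G$ isomorphic to $H$, and, when $h\mid n$, an $H$-factor in $G$ is a set of $n/h$ pairwise vertex-disjoint copies of $H$ in $G$. Let $\delta_\ell(H,n)$ be the minimum $\delta\ge 0$ such that every $r$-graph $G$ on $n$ vertices with $\delta_\ell(G)>\delta n^{r-\ell}$ has an $H$-factor, and let $\delta^*_\ell(H)=\liminf_{m\to\infty}\delta_\ell(H,mh)$. An edge-colouring of an $r$-graph on $n$ vertices is $\mu$-bounded if, for every colour, at most $\mu n^{r-1}$ edges have that colour, and every set of $r-1$ vertices is contained in at most $\mu n$ edges of that colour. An $H$-factor in an edge-coloured $r$-graph is rainbow if all edges of all its copies of $H$ have distinct colours. (i) There is $\varepsilon_0>0$ (depending only on $h,r,\ell$) such that for every $0<\varepsilon<\varepsilon_0$ there is $\mu_0>0$ such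 that for every $0<\mu<\mu_0$ there is $n_0$ such that for every $n\ge n_0$ with $h\mid n$ the following holds. Let $H$ be an $r$-graph on $h$ vertices and let $G$ be an $r$-graph on $n$ vertices with $\delta_\ell(G)\ge(\delta^*_\ell(H)+\varepsilon)n^{r-\ell}$. Then every $\mu$-bounded edge-colouring of $G$ has a rainbow $H$-factor. (ii) Consequently the asymptotic degree threshold for rainbow $H$-factors equals $\delta^*_\ell(H)$, as conversely: for every $r$-graph $H$ on $h$ vertices, all $0\le\delta<\delta^*_\ell(H)$ and all $\mu>0$, for every sufficiently large $n$ with $h\mid n$ there are an $r$-graph $G$ on $n$ vertices with $\delta_\ell(G)\ge\delta n^{r-\ell}$ and a $\mu$-bounded edge-colouring of $G$ without a rainbow $H$-factor. -/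

import Mathlib

open Filter

universe u v w

/-- An `r`-graph with vertex set `V`: a collection of `r`-element subsets of `V`. -/
structure RGraph (r : ℕ) (V : Type u) where
  /-- the edges -/
  edges : Finset (Finset V)
  /-- every edge has exactly `r` vertices -/
  card_eq : ∀ e ∈ edges, e.card = r

namespace RGraph

/-- The degree of a set `L` of vertices: the number of edges containing `L`. -/
def degree {r : ℕ} {V : Type u} [DecidableEq V] (G : RGraph r V) (L : Finset V) : ℕ :=
  (G.edges.filter (fun e => L ⊆ e)).card

/-- The minimum `ℓ`-degree `δ_ℓ(G)`: the minimum degree of a set of `ℓ` vertices. (The value is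
`0` if there are fewer than `ℓ` vertices.) -/
noncomputable def minDegree {r : ℕ} {V : Type u} [DecidableEq V] (ℓ : ℕ) (G : RGraph r V) : ℕ :=
  sInf {d : ℕ | ∃ L : Finset V, L.card = ℓ ∧ G.degree L = d}

/-- A copy of `H` in `G`: a subgraph of `G` (a vertex set and an edge set) that is isomorphic
to `H`. -/
structure Copy {r : ℕ} {U : Type u} {V : Type v} [Fintype U]
    (H : RGraph r U) (G : RGraph r V) where
  /-- the vertices of the copy -/
  verts : Finset V
  /-- the edges of the copy -/
  edges : Finset (Finset V)
  /-- the edges of the copy are edges of `G` -/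
  edges_subset : edges ⊆ G.edges
  /-- some bijection from the vertices of `H` to those of the copy carries the edges of `H`
  exactly to the edges of the copy -/
  exists_iso : ∃ f : U ↪ V, verts = Finset.univ.map f ∧
    edges = H.edges.map (Finset.mapEmbedding f).toEmbedding

/-- A partial `H`-factor in `G`: a set of pairwise vertex-disjoint copies of `H` in `G`. -/
def IsPartialFactor {r : ℕ} {U : Type u} {V : Type v} [Fintype U]
    {H : RGraph r U} {G : RGraph r V} (F : Finset (Copy H G)) : Prop :=
  (F : Set (Copy H G)).PairwiseDisjoint Copy.verts

/-- An `H`-factor in `G`: a partial `H`-factor of size `n / h`, where `h` and `n` are the numbers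
of vertices of `H` and `G`. -/
def IsFactor {r : ℕ} {U : Type u} {V : Type v} [Fintype U] [Fintype V]
    {H : RGraph r U} {G : RGraph r V} (F : Finset (Copy H G)) : Prop :=
  IsPartialFactor F ∧ F.card * Fintype.card U = Fintype.card V

/-- `δ_ℓ(H, n)`: the minimum `δ ≥ 0` such that every `r`-graph `G` on `n` vertices with
`δ_ℓ(G) > δ n ^ (r - ℓ)` has an `H`-factor. -/
noncomputable def factorThresholdAt {r : ℕ} {U : Type u} [Fintype U]
    (ℓ : ℕ) (H : RGraph r U) (n : ℕ) : ℝ :=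
  sInf {δ : ℝ | 0 ≤ δ ∧ ∀ G : RGraph r (Fin n),
    δ * (n : ℝ) ^ (r - ℓ) < (G.minDegree ℓ : ℝ) → ∃ F : Finset (Copy H G), IsFactor F}

/-- The asymptotic `ℓ`-degree threshold `δ*_ℓ(H) = liminf_{m → ∞} δ_ℓ(H, m h)` for
`H`-factors, where `h` is the number of vertices of `H`. -/
noncomputable def factorThreshold {r : ℕ} {U : Type u} [Fintype U]
    (ℓ : ℕ) (H : RGraph r U) : ℝ :=
  liminf (fun m : ℕ => factorThresholdAt ℓ H (m * Fintype.card U)) atTop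

/-- An edge-colouring `c` of an `r`-graph on `n` vertices is `μ`-bounded if for every colour `k`
there are at most `μ n ^ (r - 1)` edges of colour `k`, and any set of `r - 1` vertices is contained
in at most `μ n` edges of colour `k`. -/
def IsBounded {r : ℕ} {V : Type v} [Fintype V] {C : Type w} (G : RGraph r V)
    (c : {e : Finset V // e ∈ G.edges} → C) (μ : ℝ) : Prop :=
  ∀ k : C,
    ({e | c e = k}.ncard : ℝ) ≤ μ * (Fintype.card V : ℝ) ^ (r - 1) ∧
    ∀ I : Finset V, I.card = r - 1 →
      ({e | c e = k ∧ I ⊆ e.1}.ncard : ℝ) ≤ μ * (Fintype.card V : ℝ)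

/-- A set `F` of copies of `H` in `G` is rainbow under the edge-colouring `c` if distinct edges
belonging to members of `F` have distinct colours. -/
def IsRainbow {r : ℕ} {U : Type u} {V : Type v} [Fintype U] {C : Type w}
    {H : RGraph r U} {G : RGraph r V} (c : {e : Finset V // e ∈ G.edges} → C)
    (F : Finset (Copy H G)) : Prop :=
  Set.InjOn c {e | ∃ K ∈ F, e.1 ∈ K.edges}

end RGraph

/-! Existence of rainbow factors. The threshold hypothesis supplies arbitrarily large constants
`M`, divisible by `h`, such that minimum degree above `(δ* + ε / 4) M ^ (r - ℓ)` forces an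
`H`-factor in `r`-graphs on exactly `M` vertices, hence, with a slightly higher degree, also on
`M + h` vertices (`RGraph.exists_factor_inside_of_card`). It is therefore enough to partition the
vertices of `G` into blocks of sizes `M` and `M + h` such that the degrees inside each block are
large and all edges inside blocks have distinct colours; any choice of `H`-factors in the blocks then
gives a rainbow `H`-factor (`RGraph.exists_rainbow_factor_of_blocks`).

The partition is a uniformly random bijection `σ` from a set of positions, divided into blocks, to
the vertices. Everything to be avoided is that `σ` extends one of a family of partial injections `T`:
either `T` fills a whole block so that some degree inside it is low or two of its edges have the same
colour, or `T` puts two edges of the same colour into different blocks. For random bijections,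
avoiding events whose arguments and values are disjoint from those of `T` does not make an extension
of `T` more likely (`card_extends_mul_descFactorial_le`), so the lopsided local lemma applies. It
needs that the partial injections containing a given pair (position, vertex) have total
probability at most `κ / n` for a small `κ` (`exists_equiv_forall_not_extends`).

For low degrees this follows from the bounded differences inequality: the failure probability
is exponentially small in `M`, so it beats the number of `ℓ`-subsets and the factor `M` lost in the
local lemma (`RGraph.card_low_degree_le`). For pairs of edges of the same colour it follows from the
boundedness of the colouring: the codegree condition for two edges in one block
(`card_conflict_le`), the bound on the colour classes for different blocks
(`card_conflicting_tuples_le`), as `μ` is small in terms of `M`.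

Conversely, below the threshold there are `r`-graphs without any `H`-factor, and an injective
colouring is bounded when `n` is large. -/

/-! ### The lopsided local lemma -/

open Finset in
open scoped Classical in
/-- The lopsided local lemma for the uniform distribution on a finite set `Ω`, with the condition
that the probabilities `p j` over each neighbourhood `Γ i` add up to at most `1 / 4`. Instead of
independence it asks that conditioning on non-neighbours of `i` not occurring does not raise the
probability of `A i` above `p i`. -/
theorem lopsided_local_lemma {Ω I : Type*} [Fintype Ω] [Nonempty Ω] [Fintype I]
    (A : I → Ω → Prop) (Γ : I → I → Prop) (p : I → ℝ)
    (hp : ∀ i, 0 ≤ p i) (hΓ : ∀ i, Γ i i)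
    (hlop : ∀ i (S : Finset I), (∀ j ∈ S, ¬ Γ i j) →
      (#{ω | (∀ j ∈ S, ¬ A j ω) ∧ A i ω} : ℝ) ≤ p i * #{ω | ∀ j ∈ S, ¬ A j ω})
    (hsum : ∀ i, ∑ j with Γ i j, p j ≤ 1 / 4) :
    ∃ ω, ∀ i, ¬ A i ω := by
  -- the probability of `A i` conditional on no `A j` with `j ∈ S` is at most `2 * p i`
  have key : ∀ (N : ℕ) (S : Finset I), #S ≤ N → ∀ i,
      (#{ω | (∀ j ∈ S, ¬ A j ω) ∧ A i ω} : ℝ) ≤ 2 * p i * #{ω | ∀ j ∈ S, ¬ A j ω} := by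
    intro N
    induction N with
    | zero =>
      intro S hS i
      have hS : S = ∅ := by simpa using hS
      have := hlop i S (by simp [hS])
      have h2 : 0 ≤ p i * #{ω | ∀ j ∈ S, ¬ A j ω} := mul_nonneg (hp i) (by positivity)
      linarith
    | succ N ih =>
      intro S hS i
      set S₂ := S.filter (fun j => ¬ Γ i j) with hS₂
      set S₁ := S.filter (fun j => Γ i j) with hS₁
      have hlo := hlop i S₂ (by simp [hS₂])
      have hmono : (#{ω | (∀ j ∈ S, ¬ A j ω) ∧ A i ω} : ℝ) ≤
          #{ω | (∀ j ∈ S₂, ¬ A j ω) ∧ A i ω} := by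
        norm_cast
        apply card_le_card
        intro ω
        simp only [mem_filter, mem_univ, true_and]
        exact fun h => ⟨fun j hj => h.1 j (mem_filter.1 hj).1, h.2⟩
      by_cases hemp : S₁ = ∅
      · have hSS : S₂ = S := by
          rw [hS₂, filter_eq_self]
          intro j hj hΓj
          exact notMem_empty j (hemp ▸ mem_filter.2 ⟨hj, hΓj⟩)
        rw [hSS] at hlo
        have h2 : 0 ≤ p i * #{ω | ∀ j ∈ S, ¬ A j ω} := mul_nonneg (hp i) (by positivity)
        linarith
      · have hcard : #S₂ ≤ N := by
          have h1 : #S₁ + #S₂ = #S := card_filter_add_card_filter_not _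
          have h2 : 0 < #S₁ := card_pos.2 (nonempty_iff_ne_empty.2 hemp)
          omega
        have hsub : ({ω | ∀ j ∈ S₂, ¬ A j ω} : Finset Ω) ⊆
            ({ω | ∀ j ∈ S, ¬ A j ω} : Finset Ω) ∪
              S₁.biUnion (fun j => {ω | (∀ j ∈ S₂, ¬ A j ω) ∧ A j ω}) := by
          intro ω hω
          simp only [mem_filter, mem_univ, true_and] at hω
          simp only [mem_union, mem_biUnion, mem_filter, mem_univ, true_and]
          by_cases h : ∀ j ∈ S, ¬ A j ω
          · exact Or.inl h
          · push Not at h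
            obtain ⟨j, hj, hA⟩ := h
            refine Or.inr ⟨j, ?_, hω, hA⟩
            by_contra hcon
            exact hω j (mem_filter.2 ⟨hj, fun hg => hcon (mem_filter.2 ⟨hj, hg⟩)⟩) hA
        have hc : (#{ω | ∀ j ∈ S₂, ¬ A j ω} : ℝ) ≤ #{ω | ∀ j ∈ S, ¬ A j ω} +
            ∑ j ∈ S₁, (#{ω | (∀ j ∈ S₂, ¬ A j ω) ∧ A j ω} : ℝ) := by
          have := (card_le_card hsub).trans (card_union_le _ _)
          have := this.trans (Nat.add_le_add_left card_biUnion_le _)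
          exact_mod_cast this
        have hs : ∑ j ∈ S₁, (#{ω | (∀ j ∈ S₂, ¬ A j ω) ∧ A j ω} : ℝ) ≤
            1 / 2 * #{ω | ∀ j ∈ S₂, ¬ A j ω} := by
          calc _ ≤ ∑ j ∈ S₁, 2 * p j * #{ω | ∀ j ∈ S₂, ¬ A j ω} :=
                sum_le_sum fun j _ => ih S₂ hcard j
            _ = 2 * (∑ j ∈ S₁, p j) * #{ω | ∀ j ∈ S₂, ¬ A j ω} := by
                rw [← sum_mul, ← mul_sum]
            _ ≤ 2 * (1 / 4) * #{ω | ∀ j ∈ S₂, ¬ A j ω} := by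
                gcongr
                refine (sum_le_sum_of_subset_of_nonneg ?_ fun j _ _ => hp j).trans (hsum i)
                intro j hj
                exact mem_filter.2 ⟨mem_univ _, (mem_filter.1 hj).2⟩
            _ = _ := by ring
        have h3 : (#{ω | ∀ j ∈ S₂, ¬ A j ω} : ℝ) ≤ 2 * #{ω | ∀ j ∈ S, ¬ A j ω} := by linarith
        have := mul_le_mul_of_nonneg_left h3 (hp i)
        linarith
  have hpos : ∀ S : Finset I, 0 < #{ω | ∀ j ∈ S, ¬ A j ω} := by
    intro S
    induction S using Finset.induction_on with
    | empty => simp [Fintype.card_pos]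
    | insert i S _ ih =>
      have h1 := key _ S le_rfl i
      have h2 : p i ≤ 1 / 4 := le_trans
        (single_le_sum (f := p) (fun j _ => hp j) (mem_filter.2 ⟨mem_univ i, hΓ i⟩)) (hsum i)
      have h3 : #{ω | ∀ j ∈ S, ¬ A j ω} = #{ω | (∀ j ∈ S, ¬ A j ω) ∧ A i ω} +
          #{ω | ∀ j ∈ insert i S, ¬ A j ω} := by
        rw [← card_filter_add_card_filter_not (s := {ω | ∀ j ∈ S, ¬ A j ω}) (fun ω => A i ω),
          filter_filter, filter_filter]
        congr 2
        ext ω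
        simp [and_comm]
      have h4 : (0 : ℝ) < #{ω | ∀ j ∈ S, ¬ A j ω} := by exact_mod_cast ih
      have h5 : (#{ω | ∀ j ∈ S, ¬ A j ω} : ℝ) = #{ω | (∀ j ∈ S, ¬ A j ω) ∧ A i ω} +
          #{ω | ∀ j ∈ insert i S, ¬ A j ω} := by exact_mod_cast h3
      have h6 : (0 : ℝ) < #{ω | ∀ j ∈ insert i S, ¬ A j ω} := by nlinarith
      exact_mod_cast h6
  obtain ⟨ω, hω⟩ := card_pos.1 (hpos univ)
  exact ⟨ω, fun i => (mem_filter.1 hω).2 i (mem_univ i)⟩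

/-! ### Random bijections -/

/-- The bijection `σ` extends the partial assignment `T`, given by its set of pairs
(argument, value). -/
def Extends {P V : Type*} (σ : P ≃ V) (T : Finset (P × V)) : Prop :=
  ∀ x ∈ T, σ x.1 = x.2

open Finset in
open scoped Classical in
/-- Among the bijections that extend no member of `𝒮`, the proportion of those extending `T` is at
most what it would be among all bijections, provided that the members of `𝒮` share neither
arguments nor values with `T`. One pair `(a, b)` of `T` is freed at a time: composing with the
transposition of `b` with any value not prescribed by the rest of `T` cannot create an extension
of a member of `𝒮`. -/
theorem card_extends_mul_descFactorial_le {P V : Type*} [Fintype P] [Fintype V]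
    (𝒮 : Set (Finset (P × V))) (T : Finset (P × V))
    (hT : ∀ T' ∈ 𝒮, ∀ x ∈ T', ∀ y ∈ T, x.1 ≠ y.1 ∧ x.2 ≠ y.2) :
    #{σ : P ≃ V | (∀ T' ∈ 𝒮, ¬ Extends σ T') ∧ Extends σ T} *
      (Fintype.card V).descFactorial #T ≤ #{σ : P ≃ V | ∀ T' ∈ 𝒮, ¬ Extends σ T'} := by
  induction T using Finset.induction_on with
  | empty => simp [Extends]
  | insert y T hy ih =>
    refine le_trans ?_ (ih fun T' hT' x hx z hz => hT T' hT' x hx z (mem_insert_of_mem hz))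
    rw [card_insert_of_notMem hy, Nat.descFactorial_succ, ← mul_assoc]
    refine Nat.mul_le_mul_right _ ?_
    have hW : Fintype.card V - #T ≤ #(univ \ T.image Prod.snd) := by
      rw [card_sdiff_of_subset (subset_univ _), card_univ]
      exact Nat.sub_le_sub_left card_image_le _
    refine (Nat.mul_le_mul_left _ hW).trans ?_
    rw [← card_product]
    refine card_le_card_of_injOn (fun q => q.1.trans (Equiv.swap y.2 q.2)) ?_ ?_
    · rintro ⟨σ, w⟩ hq
      simp only [coe_product, Set.mem_prod, mem_coe, mem_filter, mem_univ, true_and] at hq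
      obtain ⟨⟨hav, hext⟩, hw⟩ := hq
      have hσy : σ y.1 = y.2 := hext y (mem_insert_self _ _)
      simp only [mem_coe, mem_filter, mem_univ, true_and]
      refine ⟨fun T' hT' hE => hav T' hT' fun x hx => ?_, fun x hx => ?_⟩
      · obtain ⟨h1, h2⟩ := hT T' hT' x hx y (mem_insert_self _ _)
        have hE' : Equiv.swap y.2 w (σ x.1) = x.2 := hE x hx
        have h3 : σ x.1 ≠ y.2 := fun h => h1 (σ.injective (h.trans hσy.symm))
        have h4 : σ x.1 ≠ w := by
          rintro h
          rw [h, Equiv.swap_apply_right] at hE'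
          exact h2 hE'.symm
        rwa [Equiv.swap_apply_of_ne_of_ne h3 h4] at hE'
      · have h1 : σ x.1 = x.2 := hext x (mem_insert_of_mem hx)
        have h2 : x.2 ≠ y.2 := by
          intro h
          have : x.1 = y.1 := σ.injective (by rw [h1, hσy, h])
          exact hy (Prod.ext this h ▸ hx)
        have h3 : x.2 ≠ w := fun h => (mem_sdiff.1 hw).2 (mem_image.2 ⟨x, hx, h⟩)
        change Equiv.swap y.2 w (σ x.1) = x.2
        rw [h1, Equiv.swap_apply_of_ne_of_ne h2 h3]
    · rintro ⟨σ, w⟩ hq ⟨σ', w'⟩ hq' h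
      simp only [coe_product, Set.mem_prod, mem_coe, mem_filter, mem_univ, true_and] at hq hq'
      have e1 : σ y.1 = y.2 := hq.1.2 y (mem_insert_self _ _)
      have e2 : σ' y.1 = y.2 := hq'.1.2 y (mem_insert_self _ _)
      have hww : w = w' := by
        have := congrArg (fun f : P ≃ V => f y.1) h
        simpa [e1, e2] using this
      subst hww
      have : σ = σ' := by
        ext x
        have := congrArg (fun f : P ≃ V => f x) h
        simpa using this
      rw [this]

open Finset in
open scoped Classical in
/-- If every pair `(a, b)` is contained in few of the partial assignments `T i`, weighted by
`n ^ (-#(T i))`, then some bijection extends none of them. -/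
theorem exists_equiv_forall_not_extends {P V I : Type*} [Fintype P] [Fintype V] [Fintype I]
    (hPV : Fintype.card P = Fintype.card V) (T : I → Finset (P × V)) {B : ℕ} {κ : ℝ}
    (hne : ∀ i, (T i).Nonempty) (hB : ∀ i, #(T i) ≤ B)
    (hn : ∀ d ≤ B, (Fintype.card V : ℝ) ^ d ≤ 2 * (Fintype.card V).descFactorial d)
    (hκ : ∀ a b, ∑ i with (a, b) ∈ T i, 1 / (Fintype.card V : ℝ) ^ #(T i) ≤
      κ / Fintype.card V)
    (hκB : 16 * B * κ ≤ 1) :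
    ∃ σ : P ≃ V, ∀ i, ¬ Extends σ (T i) := by
  have hΩ : Nonempty (P ≃ V) := ⟨Fintype.equivOfCardEq hPV⟩
  by_cases hI : IsEmpty I
  · exact ⟨hΩ.some, fun i => hI.elim i⟩
  rw [not_isEmpty_iff] at hI
  have hn0 : (0 : ℝ) < Fintype.card V := by
    obtain ⟨i⟩ := hI
    obtain ⟨x, -⟩ := hne i
    exact_mod_cast Fintype.card_pos_iff.2 ⟨x.2⟩
  set n : ℝ := (Fintype.card V : ℝ) with hndef
  have hκ0 : 0 ≤ κ := by
    obtain ⟨i⟩ := hI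
    obtain ⟨x, -⟩ := hne i
    have h1 := hκ x.1 x.2
    have h2 : 0 ≤ κ / n := le_trans (sum_nonneg fun i _ => by positivity) h1
    by_contra hneg
    exact absurd h2 (not_le.2 (div_neg_of_neg_of_pos (not_le.1 hneg) hn0))
  refine lopsided_local_lemma (fun i σ => Extends σ (T i))
    (fun i j => ∃ x ∈ T i, ∃ y ∈ T j, x.1 = y.1 ∨ x.2 = y.2)
    (fun i => 2 / n ^ #(T i)) (fun i => by positivity)
    (fun i => (hne i).elim fun x hx => ⟨x, hx, x, hx, Or.inl rfl⟩) ?_ ?_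
  · intro i S hS
    have h := card_extends_mul_descFactorial_le {T' | ∃ j ∈ S, T' = T j} (T i) (by
      rintro _ ⟨j, hj, rfl⟩ x hx y hy
      have := hS j hj
      push Not at this
      have := this y hy x hx
      exact ⟨this.1.symm, this.2.symm⟩)
    have hset : ∀ σ : P ≃ V, (∀ T' ∈ {T' | ∃ j ∈ S, T' = T j}, ¬ Extends σ T') ↔
        ∀ j ∈ S, ¬ Extends σ (T j) := by
      intro σ
      constructor
      · exact fun h j hj => h _ ⟨j, hj, rfl⟩
      · rintro h _ ⟨j, hj, rfl⟩
        exact h j hj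
    simp only [hset] at h
    have h' : (#{σ : P ≃ V | (∀ j ∈ S, ¬ Extends σ (T j)) ∧ Extends σ (T i)} : ℝ) *
        (Fintype.card V).descFactorial #(T i) ≤ #{σ : P ≃ V | ∀ j ∈ S, ¬ Extends σ (T j)} := by
      exact_mod_cast h
    rw [div_mul_eq_mul_div, le_div_iff₀ (by positivity)]
    have h3 := hn _ (hB i)
    have h4 := mul_le_mul_of_nonneg_left h3
      (Nat.cast_nonneg (α := ℝ) #{σ : P ≃ V | (∀ j ∈ S, ¬ Extends σ (T j)) ∧ Extends σ (T i)})
    linarith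
  · intro i
    have hrow : ∀ a, ∑ b : V, ∑ j with (a, b) ∈ T j, 2 / n ^ #(T j) ≤ 2 * κ := by
      intro a
      calc _ ≤ ∑ b : V, 2 * (κ / n) := by
            refine sum_le_sum fun b _ => ?_
            have := hκ a b
            simp_rw [div_eq_mul_one_div (2 : ℝ)]
            rw [← mul_sum]
            linarith
        _ = _ := by
            rw [sum_const, card_univ, nsmul_eq_mul, ← hndef]; field_simp
    have hcol : ∀ b, ∑ a : P, ∑ j with (a, b) ∈ T j, 2 / n ^ #(T j) ≤ 2 * κ := by
      intro b
      calc _ ≤ ∑ a : P, 2 * (κ / n) := by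
            refine sum_le_sum fun a _ => ?_
            have := hκ a b
            simp_rw [div_eq_mul_one_div (2 : ℝ)]
            rw [← mul_sum]
            linarith
        _ = _ := by
            rw [sum_const, card_univ, nsmul_eq_mul, hPV, ← hndef]; field_simp
    have hpt : ∀ j, (if ∃ x ∈ T i, ∃ y ∈ T j, x.1 = y.1 ∨ x.2 = y.2 then 2 / n ^ #(T j) else 0) ≤
        ∑ x ∈ T i, ((∑ b : V, if (x.1, b) ∈ T j then 2 / n ^ #(T j) else 0) +
          ∑ a : P, if (a, x.2) ∈ T j then 2 / n ^ #(T j) else 0) := by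
      intro j
      have hnn : ∀ (Q : Prop) [Decidable Q], (0 : ℝ) ≤ if Q then 2 / n ^ #(T j) else 0 := by
        intro Q _; split_ifs <;> positivity
      split_ifs with hc
      · obtain ⟨x, hx, y, hy, hxy⟩ := hc
        refine le_trans ?_ (single_le_sum (f := fun x : P × V =>
          ((∑ b : V, if (x.1, b) ∈ T j then 2 / n ^ #(T j) else 0) +
          ∑ a : P, if (a, x.2) ∈ T j then 2 / n ^ #(T j) else 0))
          (fun x _ => add_nonneg (sum_nonneg fun _ _ => hnn _) (sum_nonneg fun _ _ => hnn _)) hx)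
        rcases hxy with h | h
        · have h1 := single_le_sum (f := fun b : V => if (x.1, b) ∈ T j then 2 / n ^ #(T j) else 0)
            (fun b _ => hnn _) (mem_univ y.2)
          simp only [h, Prod.mk.eta, hy, if_true] at h1
          have h2 : 0 ≤ ∑ a : P, if (a, x.2) ∈ T j then 2 / n ^ #(T j) else 0 :=
            sum_nonneg fun _ _ => hnn _
          rw [h]
          linarith
        · have h1 := single_le_sum (f := fun a : P => if (a, x.2) ∈ T j then 2 / n ^ #(T j) else 0)
            (fun b _ => hnn _) (mem_univ y.1)
          simp only [h, Prod.mk.eta, hy, if_true] at h1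
          have h2 : 0 ≤ ∑ b : V, if (x.1, b) ∈ T j then 2 / n ^ #(T j) else 0 :=
            sum_nonneg fun _ _ => hnn _
          rw [h]
          linarith
      · exact sum_nonneg fun x _ => add_nonneg (sum_nonneg fun _ _ => hnn _)
          (sum_nonneg fun _ _ => hnn _)
    calc _ = ∑ j, (if ∃ x ∈ T i, ∃ y ∈ T j, x.1 = y.1 ∨ x.2 = y.2
            then 2 / n ^ #(T j) else 0) := by
          rw [sum_filter]
          exact sum_congr rfl fun j _ => by congr
      _ ≤ ∑ j, ∑ x ∈ T i, ((∑ b : V, if (x.1, b) ∈ T j then 2 / n ^ #(T j) else 0) +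
          ∑ a : P, if (a, x.2) ∈ T j then 2 / n ^ #(T j) else 0) := sum_le_sum fun j _ => hpt j
      _ = ∑ x ∈ T i, ((∑ b : V, ∑ j with (x.1, b) ∈ T j, 2 / n ^ #(T j)) +
          ∑ a : P, ∑ j with (a, x.2) ∈ T j, 2 / n ^ #(T j)) := by
          rw [sum_comm]
          refine sum_congr rfl fun x _ => ?_
          rw [sum_add_distrib, sum_comm, sum_comm (s := univ (α := I)) (t := univ (α := P))]
          simp_rw [sum_filter]
      _ ≤ ∑ x ∈ T i, (2 * κ + 2 * κ) :=
          sum_le_sum fun x _ => add_le_add (hrow x.1) (hcol x.2)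
      _ = #(T i) * (4 * κ) := by rw [sum_const, nsmul_eq_mul]; ring
      _ ≤ B * (4 * κ) := by
          gcongr
          exact_mod_cast hB i
      _ ≤ 1 / 4 := by linarith

/-! ### Concentration for functions of many variables -/

open Finset in
/-- The bounded differences inequality, for the uniform distribution on `Fin d → V`: if changing
one coordinate changes `f` by at most `c ≤ 1`, then the exponential moment of `f` minus its mean
is at most `exp (d c²)`. -/
theorem sum_exp_sub_mean_le {V : Type*} [Fintype V] [Nonempty V] {c : ℝ} (hc : c ≤ 1)
    (d : ℕ) (f : (Fin d → V) → ℝ)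
    (hf : ∀ ζ i x, |f (Function.update ζ i x) - f ζ| ≤ c) :
    ∑ ζ, Real.exp (f ζ - (∑ ξ, f ξ) / (Fintype.card V : ℝ) ^ d) ≤
      (Fintype.card V : ℝ) ^ d * Real.exp (d * c ^ 2) := by
  have hn : (0 : ℝ) < Fintype.card V := by exact_mod_cast Fintype.card_pos
  set n : ℝ := (Fintype.card V : ℝ) with hndef
  induction d with
  | zero => simp
  | succ d ih =>
    have hc0 : 0 ≤ c := (abs_nonneg _).trans
      (hf (fun _ => Classical.arbitrary V) 0 (Classical.arbitrary V))
    set m : ℝ := (∑ ξ, f ξ) / n ^ (d + 1) with hm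
    set g : V → ℝ := fun x => (∑ ξ : Fin d → V, f (Fin.cons x ξ)) / n ^ d with hg
    have hsplit : ∀ F : (Fin (d + 1) → V) → ℝ, ∑ ζ, F ζ = ∑ x, ∑ ξ : Fin d → V, F (Fin.cons x ξ) := by
      intro F
      rw [← Fintype.sum_prod_type' (f := fun x (ξ : Fin d → V) => F (Fin.cons x ξ))]
      exact ((Fin.consEquiv fun _ => V).sum_comp F).symm
    have hgm : ∑ x, (g x - m) = 0 := by
      rw [sum_sub_distrib, sum_const, card_univ, nsmul_eq_mul, ← hndef, hm, hsplit f, hg,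
        ← sum_div, pow_succ]
      field_simp
      ring
    have hgd : ∀ x y, |g x - g y| ≤ c := by
      intro x y
      simp only [hg]
      rw [← sub_div, ← sum_sub_distrib, abs_div, abs_of_pos (by positivity : 0 < n ^ d),
        div_le_iff₀ (by positivity)]
      calc _ ≤ ∑ ξ : Fin d → V, |f (Fin.cons x ξ) - f (Fin.cons y ξ)| := abs_sum_le_sum_abs _ _
        _ ≤ ∑ ξ : Fin d → V, c := by
            refine sum_le_sum fun ξ _ => ?_
            have := hf (Fin.cons y ξ) 0 x
            rwa [Fin.update_cons_zero] at this
        _ = c * n ^ d := by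
            rw [sum_const, card_univ, nsmul_eq_mul, Fintype.card_fun, Fintype.card_fin, hndef]
            push_cast; ring
    have hgb : ∀ x, |g x - m| ≤ c := by
      intro x
      have h1 : g x - m = (∑ y, (g x - g y)) / n := by
        have : ∑ y, g y = n * m := by
          have := hgm
          rw [sum_sub_distrib, sum_const, card_univ, nsmul_eq_mul, ← hndef] at this
          linarith
        rw [sum_sub_distrib, sum_const, card_univ, nsmul_eq_mul, ← hndef, this]
        field_simp
      rw [h1, abs_div, abs_of_pos hn, div_le_iff₀ hn]
      calc _ ≤ ∑ y, |g x - g y| := abs_sum_le_sum_abs _ _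
        _ ≤ ∑ y : V, c := sum_le_sum fun y _ => hgd x y
        _ = c * n := by rw [sum_const, card_univ, nsmul_eq_mul, ← hndef]; ring
    have hgexp : ∑ x, Real.exp (g x - m) ≤ n * Real.exp (c ^ 2) := by
      calc _ ≤ ∑ x, (1 + (g x - m) + c ^ 2) := by
            refine sum_le_sum fun x _ => ?_
            have h1 := Real.abs_exp_sub_one_sub_id_le ((hgb x).trans hc)
            have h2 := (abs_le.1 h1).2
            have h3 : (g x - m) ^ 2 ≤ c ^ 2 := sq_le_sq' (by linarith [(abs_le.1 (hgb x)).1])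
              (abs_le.1 (hgb x)).2
            linarith
        _ = n * (c ^ 2 + 1) := by
            rw [sum_add_distrib, sum_add_distrib, hgm, sum_const, sum_const, card_univ,
              nsmul_eq_mul, nsmul_eq_mul, ← hndef]
            ring
        _ ≤ _ := by gcongr; exact Real.add_one_le_exp _
    rw [hsplit]
    calc _ = ∑ x, (∑ ξ : Fin d → V, Real.exp (f (Fin.cons x ξ) - g x)) * Real.exp (g x - m) := by
          refine sum_congr rfl fun x _ => ?_
          rw [sum_mul]
          refine sum_congr rfl fun ξ _ => ?_
          rw [← Real.exp_add]
          congr 1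
          ring
      _ ≤ ∑ x, (n ^ d * Real.exp (d * c ^ 2)) * Real.exp (g x - m) := by
          refine sum_le_sum fun x _ => mul_le_mul_of_nonneg_right ?_ (Real.exp_pos _).le
          refine ih (fun ξ => f (Fin.cons x ξ)) fun ζ i y => ?_
          have := hf (Fin.cons x ζ) i.succ y
          rwa [← Fin.cons_update] at this
      _ = (n ^ d * Real.exp (d * c ^ 2)) * ∑ x, Real.exp (g x - m) := by rw [mul_sum]
      _ ≤ (n ^ d * Real.exp (d * c ^ 2)) * (n * Real.exp (c ^ 2)) := by gcongr
      _ = _ := by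
          rw [mul_mul_mul_comm, ← Real.exp_add, ← pow_succ]
          congr 2
          push_cast
          ring

open Finset in
theorem card_filter_apply_eq {ι V : Type*} [Fintype ι] [DecidableEq ι] [Fintype V] [DecidableEq V]
    (p : ι) (v : V) : #{τ : ι → V | τ p = v} = Fintype.card V ^ (Fintype.card ι - 1) := by
  have : ({τ : ι → V | τ p = v} : Finset (ι → V)) =
      Fintype.piFinset (fun i => if i = p then {v} else univ) := by
    ext τ
    simp only [mem_filter, mem_univ, true_and, Fintype.mem_piFinset]
    constructor
    · rintro h i
      split_ifs with hi
      · simp [hi, h]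
      · simp
    · intro h
      simpa using h p
  rw [this, Fintype.card_piFinset, ← mul_prod_erase _ _ (mem_univ p)]
  simp only [if_true, card_singleton, one_mul]
  rw [prod_congr rfl (g := fun _ => Fintype.card V) fun i hi => by
    simp [ne_of_mem_erase hi]]
  simp [card_erase_of_mem]

open Finset in
/-- Restriction along an injection is a uniform map. -/
theorem card_comp_injective {ι κ V : Type*} [Fintype ι] [DecidableEq ι] [Fintype κ]
    [Fintype V] [DecidableEq κ] (X : (κ → V) → Prop) [DecidablePred X] (w : κ → ι)
    (hw : Function.Injective w) :
    #{τ : ι → V | X (τ ∘ w)} * Fintype.card V ^ Fintype.card κ =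
      #{y : κ → V | X y} * Fintype.card V ^ Fintype.card ι := by
  classical
  let φ : (ι → V) ≃ (κ → V) × ({i // i ∉ Set.range w} → V) :=
    (Equiv.piEquivPiSubtypeProd (fun i => i ∈ Set.range w) (fun _ => V)).trans
      (Equiv.prodCongr (Equiv.arrowCongr (Equiv.ofInjective w hw).symm (Equiv.refl V))
        (Equiv.refl _))
  have hφ : ∀ τ, (φ τ).1 = τ ∘ w := by
    intro τ
    ext i
    simp [φ, Equiv.piEquivPiSubtypeProd, Equiv.arrowCongr, Equiv.ofInjective]
  have h1 : #{τ : ι → V | X (τ ∘ w)} =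
      #(({y : κ → V | X y} : Finset (κ → V)) ×ˢ (univ : Finset ({i // i ∉ Set.range w} → V))) := by
    refine card_bij' (fun τ _ => φ τ) (fun q _ => φ.symm q) ?_ ?_ ?_ ?_
    · intro τ hτ
      simpa [hφ] using hτ
    · intro q hq
      have := hφ (φ.symm q)
      simp only [Equiv.apply_symm_apply] at this
      simpa [← this] using hq
    · simp
    · simp
  have h2 : Fintype.card {i // i ∉ Set.range w} + Fintype.card κ = Fintype.card ι := by
    have := Fintype.card_subtype_compl (fun i => i ∈ Set.range w)
    have h3 : Fintype.card {i // i ∈ Set.range w} = Fintype.card κ :=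
      (Fintype.card_congr (Equiv.ofInjective w hw)).symm
    have h4 := Fintype.card_le_of_injective w hw
    rw [h3] at this
    omega
  rw [h1, card_product, card_univ, Fintype.card_fun, mul_assoc, ← pow_add, h2]

open Finset in
open scoped Classical in
/-- If a proportion at least `p` of the `k`-tuples of elements of `V` satisfy `X`, then for all but
an exponentially small proportion of the sequences `ζ` of length `d`, the number of `k`-tuples of
distinct entries of `ζ` satisfying `X` is not far below its expected value. -/
theorem card_few_tuples_le {V : Type*} [Fintype V] [Nonempty V] {k d : ℕ} (hk : 0 < k) (hd : 0 < d)
    (X : (Fin k → V) → Prop) {p ε : ℝ} (hε : 0 ≤ ε) (hε1 : ε ≤ 1)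
    (hp : p * (Fintype.card V : ℝ) ^ k ≤ #{y | X y}) :
    (#{ζ : Fin d → V | (#{w : Fin k ↪ Fin d | X (ζ ∘ w)} : ℝ) <
      p * d.descFactorial k - ε * (d : ℝ) ^ k} : ℝ) ≤
      Real.exp (-(ε ^ 2 / (4 * k ^ 2) * d)) * (Fintype.card V : ℝ) ^ d := by
  have hn : (0 : ℝ) < Fintype.card V := by exact_mod_cast Fintype.card_pos
  set n : ℝ := (Fintype.card V : ℝ) with hndef
  have hk' : (1 : ℝ) ≤ k := by exact_mod_cast hk
  have hd' : (1 : ℝ) ≤ d := by exact_mod_cast hd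
  set N : (Fin d → V) → ℝ := fun ζ => (#{w : Fin k ↪ Fin d | X (ζ ∘ w)} : ℝ) with hN
  -- `s` minimizes the exponent `d (s k d ^ (k - 1)) ^ 2 - s ε d ^ k` of the bound for `exp (-s N)`
  set σ : ℝ := ε / (2 * k ^ 2) with hσ
  set s : ℝ := σ / (d : ℝ) ^ (k - 1) with hs
  have hs0 : 0 ≤ s := by positivity
  -- changing one entry of `ζ` affects only the tuples that use it
  have hhit : ∀ i : Fin d, #{w : Fin k ↪ Fin d | ∃ j, w j = i} ≤ k * d ^ (k - 1) := by
    intro i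
    calc _ ≤ #((univ : Finset (Fin k)).biUnion fun j => ({w | w j = i} : Finset (Fin k → Fin d))) := by
          refine card_le_card_of_injOn (fun w => ⇑w) ?_ ?_
          · intro w hw
            simpa using hw
          · intro w _ w' _ h
            exact DFunLike.coe_injective h
      _ ≤ ∑ j : Fin k, #({w | w j = i} : Finset (Fin k → Fin d)) := card_biUnion_le
      _ = k * d ^ (k - 1) := by
          rw [sum_congr rfl fun j _ => card_filter_apply_eq j i]
          simp
  have hle : ∀ ζ ζ' : Fin d → V, ∀ i, (∀ j, j ≠ i → ζ j = ζ' j) →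
      N ζ ≤ N ζ' + k * (d : ℝ) ^ (k - 1) := by
    intro ζ ζ' i h
    have h1 : ({w : Fin k ↪ Fin d | X (ζ ∘ w)} : Finset (Fin k ↪ Fin d)) ⊆
        ({w : Fin k ↪ Fin d | X (ζ' ∘ w)} : Finset (Fin k ↪ Fin d)) ∪
          ({w : Fin k ↪ Fin d | ∃ j, w j = i} : Finset (Fin k ↪ Fin d)) := by
      intro w hw
      simp only [mem_filter, mem_univ, true_and, mem_union] at hw ⊢
      by_cases hi : ∃ j, w j = i
      · exact Or.inr hi
      · left
        push Not at hi
        have : ζ' ∘ w = ζ ∘ w := funext fun j => (h (w j) (hi j)).symm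
        rwa [this]
    have h2 := ((card_le_card h1).trans (card_union_le _ _)).trans (Nat.add_le_add_left (hhit i) _)
    simp only [hN]
    exact_mod_cast h2
  have hbd : ∀ ζ i x, |(-s * N (Function.update ζ i x)) - (-s * N ζ)| ≤ ε / (2 * k) := by
    intro ζ i x
    have h1 := hle ζ (Function.update ζ i x) i fun j hj => by simp [hj]
    have h2 := hle (Function.update ζ i x) ζ i fun j hj => by simp [hj]
    have h3 : |N (Function.update ζ i x) - N ζ| ≤ k * (d : ℝ) ^ (k - 1) :=
      abs_le.2 ⟨by linarith, by linarith⟩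
    have h4 : (-s * N (Function.update ζ i x)) - (-s * N ζ) =
        -s * (N (Function.update ζ i x) - N ζ) := by ring
    rw [h4, abs_mul, abs_neg, abs_of_nonneg hs0]
    calc _ ≤ s * (k * (d : ℝ) ^ (k - 1)) := by gcongr
      _ = ε / (2 * k) := by rw [hs, hσ]; field_simp
  have hsum : p * d.descFactorial k ≤ (∑ ζ, N ζ) / n ^ d := by
    rw [le_div_iff₀ (by positivity)]
    have h1 : ∑ ζ, N ζ = ∑ w : Fin k ↪ Fin d, (#{ζ : Fin d → V | X (ζ ∘ w)} : ℝ) := by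
      simp only [hN, card_filter, Nat.cast_sum]
      rw [sum_comm]
    rw [h1]
    calc _ = ∑ w : Fin k ↪ Fin d, p * n ^ d := by
          rw [sum_const, card_univ, Fintype.card_embedding_eq]
          simp only [Fintype.card_fin, nsmul_eq_mul]
          ring
      _ ≤ _ := by
          refine sum_le_sum fun w _ => ?_
          have h2 := card_comp_injective X w w.injective
          simp only [Fintype.card_fin] at h2
          have h3 : (#{ζ : Fin d → V | X (ζ ∘ w)} : ℝ) * n ^ k = #{y | X y} * n ^ d := by
            rw [hndef]; exact_mod_cast h2
          have h4 : 0 < n ^ k := by positivity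
          have h5 : 0 < n ^ d := by positivity
          by_contra hcon
          push Not at hcon
          have h6 := mul_lt_mul_of_pos_right hcon h4
          have h7 := mul_le_mul_of_nonneg_right hp h5.le
          linarith
  have hmain := sum_exp_sub_mean_le (c := ε / (2 * k)) (by
    rw [div_le_one (by positivity)]; linarith) d (fun ζ => -s * N ζ) hbd
  rw [← hndef, ← mul_sum, mul_div_assoc] at hmain
  set m : ℝ := (∑ ζ, N ζ) / n ^ d with hm
  have hmk : (#{ζ : Fin d → V | N ζ < p * d.descFactorial k - ε * (d : ℝ) ^ k} : ℝ) *
      Real.exp (σ * ε * d) ≤ n ^ d * Real.exp (d * (ε / (2 * k)) ^ 2) := by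
    refine le_trans ?_ hmain
    rw [← nsmul_eq_mul, ← sum_const]
    refine (sum_le_sum fun ζ hζ => ?_).trans
      (sum_le_sum_of_subset_of_nonneg (subset_univ _) fun _ _ _ => (Real.exp_pos _).le)
    rw [Real.exp_le_exp]
    have h1 := (mem_filter.1 hζ).2
    have h2 : ε * (d : ℝ) ^ k ≤ m - N ζ := by linarith
    have h3 := mul_le_mul_of_nonneg_left h2 hs0
    have h4 : s * (ε * (d : ℝ) ^ k) = σ * ε * d := by
      obtain ⟨j, rfl⟩ : ∃ j, k = j + 1 := ⟨k - 1, by omega⟩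
      rw [hs, Nat.add_sub_cancel, pow_succ]
      field_simp
    linarith
  rw [← le_div_iff₀ (Real.exp_pos _), mul_div_assoc, ← Real.exp_sub] at hmk
  refine hmk.trans (le_of_eq ?_)
  rw [mul_comm]
  congr 2
  rw [hσ]
  field_simp
  ring

/-! ### Degrees inside a set of vertices -/

namespace RGraph

/-- The edges of `G` inside `S` that contain `L`. -/
def edgesIn {r : ℕ} {V : Type u} [DecidableEq V] (G : RGraph r V) (L S : Finset V) :
    Finset (Finset V) :=
  G.edges.filter (fun e => L ⊆ e ∧ e ⊆ S)

theorem mem_edgesIn {r : ℕ} {V : Type u} [DecidableEq V] {G : RGraph r V} {L S e : Finset V} :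
    e ∈ G.edgesIn L S ↔ e ∈ G.edges ∧ L ⊆ e ∧ e ⊆ S := by
  simp [edgesIn]

/-- Every set of `ℓ` vertices in `S` is contained in at least `D` edges of `G` inside `S`. -/
def HasMinDegreeOn {r : ℕ} {V : Type u} [DecidableEq V] (G : RGraph r V) (ℓ : ℕ) (D : ℝ)
    (S : Finset V) : Prop :=
  ∀ L ⊆ S, L.card = ℓ → D ≤ (G.edgesIn L S).card

open Finset in
/-- Each edge containing `L` arises from `k!` orderings of its other `k` vertices. -/
theorem factorial_mul_degree_le {r ℓ k : ℕ} {V : Type u} [Fintype V] [DecidableEq V]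
    (G : RGraph r V) (hr : ℓ + k = r) (L : Finset V) (hL : #L = ℓ) :
    k.factorial * G.degree L ≤ #{y : Fin k → V | L ∪ univ.image y ∈ G.edges} := by
  have hmaps : ∀ e ∈ G.edges.filter (fun e => L ⊆ e), k.factorial ≤
      #{y ∈ ({y : Fin k → V | L ∪ univ.image y ∈ G.edges} : Finset (Fin k → V)) |
        L ∪ univ.image y = e} := by
    intro e he
    obtain ⟨he, hLe⟩ := mem_filter.1 he
    have hcard : #(e \ L) = k := by
      rw [card_sdiff_of_subset hLe, G.card_eq e he, hL]; omega
    have h1 : Fintype.card (Fin k ↪ (e \ L : Finset V)) = k.factorial := by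
      rw [Fintype.card_embedding_eq, Fintype.card_coe, hcard, Fintype.card_fin,
        Nat.descFactorial_self]
    rw [← h1, ← card_univ]
    refine card_le_card_of_injOn (fun w i => (w i : V)) ?_ ?_
    · intro w _
      have himg : univ.image (fun i => (w i : V)) = e \ L := by
        refine eq_of_subset_of_card_le ?_ ?_
        · intro x hx
          obtain ⟨i, -, rfl⟩ := mem_image.1 hx
          exact (w i).2
        · rw [card_image_of_injective _ (fun i j hij => w.injective (Subtype.ext hij)), card_univ,
            Fintype.card_fin, hcard]
      have h2 : L ∪ univ.image (fun i => (w i : V)) = e := by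
        rw [himg, union_sdiff_of_subset hLe]
      exact mem_coe.2 (mem_filter.2 ⟨mem_filter.2 ⟨mem_univ _, by rwa [h2]⟩, h2⟩)
    · intro w _ w' _ h
      ext i
      exact congrFun h i
  have h := card_nsmul_le_sum _ _ _ hmaps
  rw [smul_eq_mul] at h
  rw [degree, mul_comm]
  refine h.trans ?_
  rw [← card_biUnion]
  · refine card_le_card fun y hy => ?_
    obtain ⟨e, -, hy⟩ := mem_biUnion.1 hy
    exact (mem_filter.1 hy).1
  · intro e _ e' _ hne
    rw [Function.onFun, disjoint_left]
    intro y hy hy'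
    exact hne ((mem_filter.1 hy).2.symm.trans (mem_filter.1 hy').2)

open Finset in
theorem card_embedding_le_factorial_mul_card_edgesIn {r ℓ k d : ℕ} {V : Type u} [DecidableEq V]
    (G : RGraph r V) (hr : ℓ + k = r) (L S : Finset V) (hL : #L = ℓ) (hLS : L ⊆ S)
    (ζ : Fin d → V) (hζ : Function.Injective ζ) (hζS : ∀ i, ζ i ∈ S) :
    #{w : Fin k ↪ Fin d | L ∪ univ.image (ζ ∘ w) ∈ G.edges} ≤ k.factorial * #(G.edgesIn L S) := by
  rw [mul_comm]
  have hmaps : ∀ w ∈ ({w : Fin k ↪ Fin d | L ∪ univ.image (ζ ∘ w) ∈ G.edges} : Finset _),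
      L ∪ univ.image (ζ ∘ w) ∈ G.edgesIn L S := by
    intro w hw
    refine mem_edgesIn.2 ⟨(mem_filter.1 hw).2, subset_union_left, union_subset hLS ?_⟩
    intro x hx
    obtain ⟨i, -, rfl⟩ := mem_image.1 hx
    exact hζS _
  rw [card_eq_sum_card_fiberwise hmaps, ← smul_eq_mul]
  refine sum_le_card_nsmul _ _ _ fun e he => ?_
  obtain ⟨he, hLe, -⟩ := mem_edgesIn.1 he
  have hcard : #(e \ L) = k := by
    rw [card_sdiff_of_subset hLe, G.card_eq e he, hL]; omega
  have h1 : Fintype.card (Fin k ↪ (e \ L : Finset V)) = k.factorial := by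
    rw [Fintype.card_embedding_eq, Fintype.card_coe, hcard, Fintype.card_fin,
      Nat.descFactorial_self]
  rw [← h1, ← Fintype.card_coe]
  have hval : ∀ w : Fin k ↪ Fin d, L ∪ univ.image (ζ ∘ w) = e → ∀ i, ζ (w i) ∈ e \ L := by
    intro w hw i
    have h2 : e \ L ⊆ univ.image (ζ ∘ w) := by
      rw [← hw]
      intro x hx
      obtain ⟨hx1, hx2⟩ := Finset.mem_sdiff.1 hx
      exact (Finset.mem_union.1 hx1).resolve_left hx2
    have h3 : univ.image (ζ ∘ w) = e \ L :=
      (eq_of_subset_of_card_le h2 (by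
        rw [hcard]; exact card_image_le.trans (by simp))).symm
    rw [← h3]
    exact mem_image.2 ⟨i, mem_univ _, rfl⟩
  refine Fintype.card_le_of_injective
    (fun w => ⟨fun i => ⟨ζ (w.1 i), hval w.1 (mem_filter.1 w.2).2 i⟩, fun i j hij => ?_⟩) ?_
  · exact w.1.injective (hζ (congrArg Subtype.val hij))
  · rintro ⟨w, hw⟩ ⟨w', hw'⟩ h
    ext i
    have h4 := congrArg (fun g : Fin k ↪ (e \ L : Finset V) => (g i : V)) h
    exact congrArg Fin.val (hζ h4)

open Finset in
open scoped Classical in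
/-- A random sequence `τ` with `τ p = v` gives a low degree to the set of its entries at the
positions `A` with exponentially small probability. -/
theorem card_low_degree_at_le {r ℓ k b : ℕ} {V : Type u} [Fintype V] [DecidableEq V]
    (G : RGraph r V) (hr : ℓ + k = r) (hk : 0 < k) (A : Finset (Fin b)) (hA : #A = ℓ)
    (hb : ℓ + 1 < b) {α ε D : ℝ} (hε : 0 ≤ ε) (hε1 : ε ≤ 1)
    (hG : ∀ L : Finset V, #L = ℓ → α * (Fintype.card V : ℝ) ^ k ≤ G.degree L)
    (hD : ∀ d ≤ b, b ≤ d + ℓ + 1 →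
      k.factorial * D ≤ k.factorial * α * d.descFactorial k - ε * (d : ℝ) ^ k)
    (p : Fin b) (v : V) :
    (#{τ : Fin b → V | τ p = v ∧ Function.Injective τ ∧
      (#(G.edgesIn (A.image τ) (univ.image τ)) : ℝ) < D} : ℝ) ≤
      Real.exp (-(ε ^ 2 / (4 * k ^ 2) * (b - ℓ - 1 : ℝ))) * (Fintype.card V : ℝ) ^ (b - 1) := by
  have : Nonempty V := ⟨v⟩
  set Y : Finset (Fin b) := insert p A with hY
  set d := Fintype.card {i // i ∉ Y} with hd
  have hYd : d + #Y = b := by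
    have := Fintype.card_subtype_compl (fun i => i ∈ Y)
    rw [Fintype.card_coe, Fintype.card_fin, ← hd] at this
    have h2 := card_le_univ Y
    rw [Fintype.card_fin] at h2
    omega
  have hYle : #Y ≤ ℓ + 1 := by rw [← hA]; exact card_insert_le _ _
  have hYpos : 0 < #Y := card_pos.2 ⟨p, mem_insert_self _ _⟩
  have hdpos : 0 < d := by omega
  let z : Fin d ≃ {i // i ∉ Y} := (Fintype.equivFin _).symm
  have hAY : ∀ a ∈ A, a ∈ Y := fun a ha => mem_insert_of_mem ha
  -- condition on the entries at `Y`: they determine the set `L g` whose degree is considered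
  let L : (Y → V) → Finset V := fun g => A.attach.image fun a => g ⟨a.1, hAY a.1 a.2⟩
  set ρ : ℝ := Real.exp (-(ε ^ 2 / (4 * k ^ 2) * (b - ℓ - 1 : ℝ))) with hρ
  set s : Finset (Fin b → V) := {τ : Fin b → V | τ p = v ∧ Function.Injective τ ∧
      (#(G.edgesIn (A.image τ) (univ.image τ)) : ℝ) < D} with hs
  set t : Finset (Y → V) := {g | g ⟨p, mem_insert_self _ _⟩ = v} with ht
  have hmaps : ∀ τ ∈ s, (fun q : Y => τ q) ∈ t := by
    intro τ hτ
    simp only [hs, mem_filter, mem_univ, true_and] at hτ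
    simp [ht, hτ.1]
  have hfib : ∀ g ∈ t, (#{τ ∈ s | (fun q : Y => τ q) = g} : ℝ) ≤
      ρ * (Fintype.card V : ℝ) ^ d := by
    intro g _
    have hLτ : ∀ τ : Fin b → V, (fun q : Y => τ q) = g → A.image τ = L g := by
      rintro τ rfl
      ext x
      simp [L]
    by_cases hLc : #(L g) = ℓ
    · have hX := factorial_mul_degree_le G hr (L g) hLc
      have hX' : k.factorial * α * (Fintype.card V : ℝ) ^ k ≤
          #{y : Fin k → V | L g ∪ univ.image y ∈ G.edges} := by
        calc _ = k.factorial * (α * (Fintype.card V : ℝ) ^ k) := by ring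
          _ ≤ (k.factorial : ℝ) * G.degree (L g) := by gcongr; exact hG _ hLc
          _ ≤ _ := by exact_mod_cast hX
      have hfew := card_few_tuples_le hk hdpos (fun y : Fin k → V => L g ∪ univ.image y ∈ G.edges)
        (p := k.factorial * α) hε hε1 (hX'.trans (le_of_eq (by congr)))
      refine le_trans ?_ (hfew.trans ?_)
      · refine Nat.cast_le.2 (card_le_card_of_injOn (fun τ => fun i => τ (z i)) ?_ ?_)
        · intro τ hτ
          obtain ⟨hτs, hg⟩ := mem_filter.1 (mem_coe.1 hτ)
          obtain ⟨-, hinj, hlow⟩ := (mem_filter.1 hτs).2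
          refine mem_coe.2 (mem_filter.2 ⟨mem_univ _, ?_⟩)
          rw [hLτ τ hg] at hlow
          have h1 := card_embedding_le_factorial_mul_card_edgesIn (k := k) G hr (L g)
            (univ.image τ) hLc (by
              rw [← hLτ τ hg]; exact image_subset_image (subset_univ _))
            (fun i => τ (z i)) (fun i j hij => z.injective (Subtype.ext (hinj hij)))
            (fun i => mem_image_of_mem _ (mem_univ _))
          have h2 : (#{w : Fin k ↪ Fin d | L g ∪ univ.image ((fun i => τ (z i)) ∘ w) ∈ G.edges} : ℝ)
            ≤ k.factorial * #(G.edgesIn (L g) (univ.image τ)) := by exact_mod_cast h1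
          have h3 : (k.factorial : ℝ) * #(G.edgesIn (L g) (univ.image τ)) < k.factorial * D := by
            have : (0 : ℝ) < k.factorial := by exact_mod_cast k.factorial_pos
            gcongr
          have h4 := hD d (by omega) (by omega)
          refine lt_of_le_of_lt (le_of_eq ?_) ((h2.trans_lt h3).trans_le h4)
          congr
        · intro τ hτ τ' hτ' h
          have e1 := (mem_filter.1 (mem_coe.1 hτ)).2
          have e2 := (mem_filter.1 (mem_coe.1 hτ')).2
          ext i
          by_cases hi : i ∈ Y
          · exact (congrFun e1 ⟨i, hi⟩).trans (congrFun e2 ⟨i, hi⟩).symm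
          · have := congrFun h (z.symm ⟨i, hi⟩)
            simpa using this
      · refine mul_le_mul_of_nonneg_right ?_ (by positivity)
        rw [hρ, Real.exp_le_exp, neg_le_neg_iff]
        gcongr
        have : (b : ℝ) ≤ d + (ℓ + 1) := by
          have : b ≤ d + (ℓ + 1) := by omega
          exact_mod_cast this
        linarith
    · have hemp : ({τ ∈ s | (fun q : Y => τ q) = g} : Finset (Fin b → V)) = ∅ := by
        rw [filter_eq_empty_iff]
        intro τ hτ hg
        simp only [hs, mem_filter, mem_univ, true_and] at hτ
        apply hLc
        rw [← hLτ τ hg, card_image_of_injective _ hτ.2.1, hA]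
      rw [hemp]
      simp only [card_empty, Nat.cast_zero]
      positivity
  have hcard : #t = Fintype.card V ^ (#Y - 1) := by
    have := card_filter_apply_eq (⟨p, mem_insert_self _ _⟩ : Y) v
    rw [Fintype.card_coe] at this
    rw [← this]
  calc (#s : ℝ) = ∑ g ∈ t, (#{τ ∈ s | (fun q : Y => τ q) = g} : ℝ) := by
        exact_mod_cast card_eq_sum_card_fiberwise hmaps
    _ ≤ #t • (ρ * (Fintype.card V : ℝ) ^ d) := sum_le_card_nsmul _ _ _ hfib
    _ = ρ * (Fintype.card V : ℝ) ^ (b - 1) := by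
        have : b - 1 = (#Y - 1) + d := by omega
        rw [nsmul_eq_mul, hcard, this, pow_add]
        push_cast
        ring

open Finset in
open scoped Classical in
/-- A random sequence `τ` with `τ p = v` gives a low degree to some `ℓ` of its entries with
exponentially small probability. -/
theorem card_low_degree_le {r ℓ k b : ℕ} {V : Type u} [Fintype V] [DecidableEq V]
    (G : RGraph r V) (hr : ℓ + k = r) (hk : 0 < k)
    (hb : ℓ + 1 < b) {α ε D : ℝ} (hε : 0 ≤ ε) (hε1 : ε ≤ 1)
    (hG : ∀ L : Finset V, #L = ℓ → α * (Fintype.card V : ℝ) ^ k ≤ G.degree L)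
    (hD : ∀ d ≤ b, b ≤ d + ℓ + 1 →
      k.factorial * D ≤ k.factorial * α * d.descFactorial k - ε * (d : ℝ) ^ k)
    (p : Fin b) (v : V) :
    (#{τ : Fin b → V | τ p = v ∧ Function.Injective τ ∧
      ¬ G.HasMinDegreeOn ℓ D (univ.image τ)} : ℝ) ≤
      (b : ℝ) ^ ℓ * Real.exp (-(ε ^ 2 / (4 * k ^ 2) * (b - ℓ - 1 : ℝ))) *
        (Fintype.card V : ℝ) ^ (b - 1) := by
  have hsub : ({τ : Fin b → V | τ p = v ∧ Function.Injective τ ∧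
      ¬ G.HasMinDegreeOn ℓ D (univ.image τ)} : Finset _) ⊆
      (powersetCard ℓ (univ : Finset (Fin b))).biUnion fun A =>
        ({τ : Fin b → V | τ p = v ∧ Function.Injective τ ∧
          (#(G.edgesIn (A.image τ) (univ.image τ)) : ℝ) < D} : Finset _) := by
    intro τ hτ
    obtain ⟨hv, hinj, hlow⟩ := (mem_filter.1 hτ).2
    simp only [HasMinDegreeOn, not_forall, not_le] at hlow
    obtain ⟨L, hLS, hL, hlow⟩ := hlow
    have himg : (univ.filter fun i => τ i ∈ L).image τ = L := by
      ext x
      simp only [mem_image, mem_filter, mem_univ, true_and]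
      constructor
      · rintro ⟨i, hi, rfl⟩
        exact hi
      · intro hx
        obtain ⟨i, -, rfl⟩ := mem_image.1 (hLS hx)
        exact ⟨i, hx, rfl⟩
    refine mem_biUnion.2 ⟨univ.filter fun i => τ i ∈ L, ?_, ?_⟩
    · rw [mem_powersetCard]
      refine ⟨subset_univ _, ?_⟩
      rw [← hL, ← card_image_of_injective _ hinj, himg]
    · simp only [mem_filter, mem_univ, true_and]
      rw [himg]
      exact ⟨hv, hinj, hlow⟩
  have h1 : (#{τ : Fin b → V | τ p = v ∧ Function.Injective τ ∧
      ¬ G.HasMinDegreeOn ℓ D (univ.image τ)} : ℝ) ≤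
      ∑ A ∈ powersetCard ℓ (univ : Finset (Fin b)),
        (#{τ : Fin b → V | τ p = v ∧ Function.Injective τ ∧
          (#(G.edgesIn (A.image τ) (univ.image τ)) : ℝ) < D} : ℝ) := by
    exact_mod_cast (card_le_card hsub).trans card_biUnion_le
  refine h1.trans ((sum_le_card_nsmul _ _ _ fun A hA =>
    card_low_degree_at_le G hr hk A (mem_powersetCard.1 hA).2 hb hε hε1 hG hD p v).trans ?_)
  rw [nsmul_eq_mul, card_powersetCard, card_univ, Fintype.card_fin, mul_assoc]
  refine mul_le_mul_of_nonneg_right ?_ (by positivity)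
  exact_mod_cast Nat.choose_le_pow b ℓ

end RGraph

/-! ### Conflicting pairs of edges -/

/-- No two distinct subsets of `S` are related by `R`. For a symmetric `R` that relates the edges of
the same colour, this says that all edges inside `S` have distinct colours. -/
def ConflictFree {V : Type u} (R : Finset V → Finset V → Prop) (S : Finset V) : Prop :=
  ∀ e ⊆ S, ∀ f ⊆ S, R e f → e = f

open Finset in
open scoped Classical in
/-- When all entries of `τ` but the one at a position `q` in `F` and not in `E` are fixed, the first
set and all but one element of the second are determined. -/
theorem card_conflict_at_le {V : Type u} [Fintype V] [DecidableEq V] {r b : ℕ}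
    {R : Finset V → Finset V → Prop} {μ : ℝ} (hμ : 0 ≤ μ)
    (hR : ∀ e I : Finset V, #I = r - 1 → (#{x | R e (insert x I)} : ℝ) ≤ μ * Fintype.card V)
    {E F : Finset (Fin b)} (hF : #F = r) {p q : Fin b} (hqF : q ∈ F) (hqE : q ∉ E) (hqp : q ≠ p)
    (v : V) :
    (#{τ : Fin b → V | τ p = v ∧ Function.Injective τ ∧ R (E.image τ) (F.image τ)} : ℝ) ≤
      μ * (Fintype.card V : ℝ) ^ (b - 1) := by
  set s : Finset (Fin b → V) :=
    {τ | τ p = v ∧ Function.Injective τ ∧ R (E.image τ) (F.image τ)} with hs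
  set t : Finset ({i // i ≠ q} → V) := {g | g ⟨p, hqp.symm⟩ = v} with ht
  have hmaps : ∀ τ ∈ s, (fun i : {i // i ≠ q} => τ i) ∈ t := by
    intro τ hτ
    have := (mem_filter.1 hτ).2
    exact mem_filter.2 ⟨mem_univ _, this.1⟩
  have hfib : ∀ g ∈ t, (#{τ ∈ s | (fun i : {i // i ≠ q} => τ i) = g} : ℝ) ≤
      μ * Fintype.card V := by
    intro g _
    rcases ({τ ∈ s | (fun i : {i // i ≠ q} => τ i) = g} : Finset _).eq_empty_or_nonempty with
      h | ⟨τ₀, h₀⟩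
    · rw [h]
      simp only [card_empty, Nat.cast_zero]
      positivity
    · obtain ⟨hτ₀, hg₀⟩ := mem_filter.1 h₀
      obtain ⟨-, hinj₀, -⟩ := (mem_filter.1 hτ₀).2
      have hI : #((F.erase q).image τ₀) = r - 1 := by
        rw [card_image_of_injective _ hinj₀, card_erase_of_mem hqF, hF]
      refine le_trans (Nat.cast_le.2 (card_le_card_of_injOn (fun τ => τ q) ?_ ?_))
        (hR (E.image τ₀) ((F.erase q).image τ₀) hI)
      · intro τ hτ
        obtain ⟨hτs, hg⟩ := mem_filter.1 (mem_coe.1 hτ)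
        obtain ⟨-, -, hRτ⟩ := (mem_filter.1 hτs).2
        have hagree : ∀ i, i ≠ q → τ i = τ₀ i := fun i hi =>
          congrFun (hg.trans hg₀.symm) ⟨i, hi⟩
        refine mem_coe.2 (mem_filter.2 ⟨mem_univ _, ?_⟩)
        have h1 : E.image τ = E.image τ₀ :=
          image_congr fun i hi => hagree i fun h => hqE (h ▸ hi)
        have h2 : F.image τ = insert (τ q) ((F.erase q).image τ₀) := by
          rw [← insert_erase hqF, image_insert, erase_insert (notMem_erase _ _)]
          congr 1
          exact image_congr fun i hi => hagree i (ne_of_mem_erase hi)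
        rwa [h1, h2] at hRτ
      · intro τ hτ τ' hτ' h
        have e1 := (mem_filter.1 (mem_coe.1 hτ)).2
        have e2 := (mem_filter.1 (mem_coe.1 hτ')).2
        ext i
        by_cases hi : i = q
        · rw [hi]; exact h
        · exact congrFun (e1.trans e2.symm) ⟨i, hi⟩
  have hb : 2 ≤ b := by
    have h1 := q.2
    have h2 := p.2
    have h3 : (q : ℕ) ≠ p := fun h => hqp (Fin.ext h)
    omega
  have hcard : #t = Fintype.card V ^ (b - 2) := by
    have := card_filter_apply_eq (⟨p, hqp.symm⟩ : {i // i ≠ q}) v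
    have hc : Fintype.card {i // i ≠ q} - 1 = b - 2 := by
      rw [Fintype.card_subtype_compl, Fintype.card_subtype_eq, Fintype.card_fin]
      omega
    rw [hc] at this
    rw [← this]
  calc (#s : ℝ) = ∑ g ∈ t, (#{τ ∈ s | (fun i : {i // i ≠ q} => τ i) = g} : ℝ) := by
        exact_mod_cast card_eq_sum_card_fiberwise hmaps
    _ ≤ #t • (μ * (Fintype.card V : ℝ)) := sum_le_card_nsmul _ _ _ hfib
    _ = μ * (Fintype.card V : ℝ) ^ (b - 1) := by
        have : b - 1 = (b - 2) + 1 := by omega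
        rw [nsmul_eq_mul, hcard, this, pow_succ]
        push_cast
        ring

open Finset in
open scoped Classical in
/-- The sequences `τ` with `τ p = v` whose set of entries contains two distinct conflicting
`r`-sets are few, if no `(r - 1)`-set has many extensions that conflict with a given set. -/
theorem card_conflict_le {V : Type u} [Fintype V] [DecidableEq V] {r b : ℕ}
    {R : Finset V → Finset V → Prop} {μ : ℝ} (hμ : 0 ≤ μ)
    (hsymm : ∀ e f, R e f → R f e) (hcard : ∀ e f, R e f → #e = r)
    (hR : ∀ e I : Finset V, #I = r - 1 → (#{x | R e (insert x I)} : ℝ) ≤ μ * Fintype.card V)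
    (p : Fin b) (v : V) :
    (#{τ : Fin b → V | τ p = v ∧ Function.Injective τ ∧
      ¬ ConflictFree R (univ.image τ)} : ℝ) ≤
      4 ^ b * μ * (Fintype.card V : ℝ) ^ (b - 1) := by
  set pairs : Finset (Finset (Fin b) × Finset (Fin b)) :=
    {x | x.1 ≠ x.2 ∧ #x.1 = r ∧ #x.2 = r} with hpairs
  have hsub : ({τ : Fin b → V | τ p = v ∧ Function.Injective τ ∧
      ¬ ConflictFree R (univ.image τ)} : Finset _) ⊆
      pairs.biUnion fun x =>
        ({τ : Fin b → V | τ p = v ∧ Function.Injective τ ∧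
          R (x.1.image τ) (x.2.image τ)} : Finset _) := by
    intro τ hτ
    obtain ⟨hv, hinj, hcon⟩ := (mem_filter.1 hτ).2
    simp only [ConflictFree, not_forall] at hcon
    obtain ⟨e, he, f, hf, hRef, hne⟩ := hcon
    have himg : ∀ L ⊆ univ.image τ, (univ.filter fun i => τ i ∈ L).image τ = L := by
      intro L hLS
      ext x
      simp only [mem_image, mem_filter, mem_univ, true_and]
      constructor
      · rintro ⟨i, hi, rfl⟩
        exact hi
      · intro hx
        obtain ⟨i, -, rfl⟩ := mem_image.1 (hLS hx)
        exact ⟨i, hx, rfl⟩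
    refine mem_biUnion.2 ⟨(univ.filter fun i => τ i ∈ e, univ.filter fun i => τ i ∈ f), ?_, ?_⟩
    · refine mem_filter.2 ⟨mem_univ _, fun h => hne ?_, ?_, ?_⟩
      · rw [← himg e he, ← himg f hf]
        exact congrArg (fun A => A.image τ) h
      · rw [← hcard e f hRef, ← card_image_of_injective _ hinj, himg e he]
      · rw [← hcard f e (hsymm _ _ hRef), ← card_image_of_injective _ hinj, himg f hf]
    · refine mem_filter.2 ⟨mem_univ _, hv, hinj, ?_⟩
      rwa [himg e he, himg f hf]
  have h1 := Nat.cast_le (α := ℝ).2 ((card_le_card hsub).trans card_biUnion_le)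
  rw [Nat.cast_sum] at h1
  refine h1.trans ((sum_le_card_nsmul _ _ (μ * (Fintype.card V : ℝ) ^ (b - 1)) ?_).trans ?_)
  · intro x hx
    obtain ⟨hne, h1, h2⟩ := (mem_filter.1 hx).2
    -- one of the two sets has an element other than `p` that is not in the other
    have h3 : (x.2 \ x.1).Nonempty := by
      rw [sdiff_nonempty]
      exact fun h => hne (eq_of_subset_of_card_le h (by omega)).symm
    have h4 : (x.1 \ x.2).Nonempty := by
      rw [sdiff_nonempty]
      exact fun h => hne (eq_of_subset_of_card_le h (by omega))
    obtain ⟨q, hq⟩ := h3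
    obtain ⟨q', hq'⟩ := h4
    obtain ⟨hq1, hq2⟩ := Finset.mem_sdiff.1 hq
    obtain ⟨hq1', hq2'⟩ := Finset.mem_sdiff.1 hq'
    by_cases hqp : q = p
    · have hqp' : q' ≠ p := by
        rintro rfl
        exact hq2' (hqp ▸ hq1)
      refine le_trans ?_ (card_conflict_at_le hμ hR h1 hq1' hq2' hqp' v)
      refine Nat.cast_le.2 (card_le_card fun τ hτ => ?_)
      obtain ⟨a1, a2, a3⟩ := (mem_filter.1 hτ).2
      exact mem_filter.2 ⟨mem_univ _, a1, a2, hsymm _ _ a3⟩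
    · exact card_conflict_at_le hμ hR h2 hq1 hq2 hqp v
  · rw [nsmul_eq_mul, mul_assoc]
    refine mul_le_mul_of_nonneg_right ?_ (by positivity)
    have : #pairs ≤ 4 ^ b := by
      refine (card_le_univ _).trans (le_of_eq ?_)
      rw [Fintype.card_prod, Fintype.card_finset, Fintype.card_fin, ← mul_pow]
      norm_num
    exact_mod_cast this

open Finset in
open scoped Classical in
theorem card_conflicting_tuples_le {V : Type u} [Fintype V] [DecidableEq V] {r : ℕ}
    {R : Finset V → Finset V → Prop} {μ : ℝ}
    (hsymm : ∀ e f, R e f → R f e) (hcard : ∀ e f, R e f → #e = r)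
    (hR : ∀ e, (#{f | R e f} : ℝ) ≤ μ * (Fintype.card V : ℝ) ^ (r - 1)) (s : Fin r) (v : V) :
    (#{x : (Fin r → V) × (Fin r → V) | x.1 s = v ∧ R (univ.image x.1) (univ.image x.2)} : ℝ) ≤
      (Fintype.card V : ℝ) ^ (r - 1) * (r ^ r * (μ * (Fintype.card V : ℝ) ^ (r - 1))) := by
  have htup : ∀ e, (#{b : Fin r → V | R e (univ.image b)} : ℝ) ≤
      r ^ r * (μ * (Fintype.card V : ℝ) ^ (r - 1)) := by
    intro e
    have hsub : ({b : Fin r → V | R e (univ.image b)} : Finset _) ⊆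
        ({f | R e f} : Finset (Finset V)).biUnion fun f => Fintype.piFinset fun _ : Fin r => f := by
      intro b hb
      refine mem_biUnion.2 ⟨univ.image b, mem_filter.2 ⟨mem_univ _, (mem_filter.1 hb).2⟩, ?_⟩
      exact Fintype.mem_piFinset.2 fun i => mem_image_of_mem _ (mem_univ _)
    have h1 := (card_le_card hsub).trans (card_biUnion_le.trans
      (sum_le_card_nsmul _ _ (r ^ r) fun f hf => ?_))
    · have h2 : (#{b : Fin r → V | R e (univ.image b)} : ℝ) ≤ #{f | R e f} * (r : ℝ) ^ r := by
        rw [smul_eq_mul] at h1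
        exact_mod_cast h1
      refine h2.trans ?_
      rw [mul_comm]
      exact mul_le_mul_of_nonneg_left (hR e) (by positivity)
    · rw [Fintype.card_piFinset, prod_const, hcard f e (hsymm _ _ (mem_filter.1 hf).2), card_univ,
        Fintype.card_fin]
  have hmaps : ∀ x ∈ ({x : (Fin r → V) × (Fin r → V) | x.1 s = v ∧
      R (univ.image x.1) (univ.image x.2)} : Finset _), x.1 ∈ ({a | a s = v} : Finset _) := by
    intro x hx
    exact mem_filter.2 ⟨mem_univ _, (mem_filter.1 hx).2.1⟩
  have h1 := card_eq_sum_card_fiberwise hmaps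
  rw [h1, Nat.cast_sum]
  refine (sum_le_card_nsmul _ _ (r ^ r * (μ * (Fintype.card V : ℝ) ^ (r - 1))) ?_).trans ?_
  · intro a _
    refine le_trans (Nat.cast_le.2 (card_le_card_of_injOn Prod.snd ?_ ?_)) (htup (univ.image a))
    · intro x hx
      obtain ⟨h2, rfl⟩ := mem_filter.1 (mem_coe.1 hx)
      exact mem_coe.2 (mem_filter.2 ⟨mem_univ _, (mem_filter.1 h2).2.2⟩)
    · intro x hx y hy h
      have e1 := (mem_filter.1 (mem_coe.1 hx)).2
      have e2 := (mem_filter.1 (mem_coe.1 hy)).2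
      exact Prod.ext (e1.trans e2.symm) h
  · have := card_filter_apply_eq s v
    rw [Fintype.card_fin] at this
    rw [nsmul_eq_mul]
    refine le_of_eq ?_
    congr 1
    rw [← Nat.cast_pow, ← this]

/-! ### Partitions into good blocks -/

open Finset in
open scoped Classical in
/-- A set of `Fintype.card V` positions is divided into blocks of bounded sizes `sz i`. If few of
the ways of filling a block are bad, and few pairs of `r`-sets conflict, then the positions can be
filled with the elements of `V` such that no block is bad and there are no conflicts between
different blocks. -/
theorem exists_good_blocks {V : Type u} [Fintype V] [DecidableEq V] {r q B : ℕ} (hr : 0 < r)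
    (sz : Fin q → ℕ) (hsz : ∑ i, sz i = Fintype.card V) (hpos : ∀ i, 0 < sz i)
    (hszB : ∀ i, sz i ≤ B) (hrB : 2 * r ≤ B)
    (Bad : ∀ i, (Fin (sz i) → V) → Prop) {η μ : ℝ}
    (hη : ∀ i p v, (#{τ : Fin (sz i) → V | τ p = v ∧ Bad i τ} : ℝ) ≤
      η * (Fintype.card V : ℝ) ^ (sz i - 1))
    (R : Finset V → Finset V → Prop)
    (hsymm : ∀ e f, R e f → R f e) (hcard : ∀ e f, R e f → #e = r)
    (hR : ∀ e, (#{f | R e f} : ℝ) ≤ μ * (Fintype.card V : ℝ) ^ (r - 1))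
    (hn : ∀ d ≤ B, (Fintype.card V : ℝ) ^ d ≤ 2 * (Fintype.card V).descFactorial d)
    (hsmall : 16 * B * (η + 2 * r ^ (r + 1) * B ^ (2 * r) * μ) ≤ 1) :
    ∃ σ : (Σ i, Fin (sz i)) ≃ V, (∀ i, ¬ Bad i (fun s => σ ⟨i, s⟩)) ∧
      ∀ i j, i ≠ j → ∀ e ⊆ univ.image (fun s => σ ⟨i, s⟩), ∀ f ⊆ univ.image (fun s => σ ⟨j, s⟩),
        ¬ R e f := by
  let P := Σ i, Fin (sz i)
  have hPV : Fintype.card P = Fintype.card V := 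
    Fintype.card_sigma.trans (by simpa using hsz)
  have hq : q ≤ Fintype.card V := by
    rw [← hsz]
    calc q = ∑ i : Fin q, 1 := by simp
      _ ≤ _ := sum_le_sum fun i _ => hpos i
  -- Events of the first kind (`I₁`, `T₁`) fill a block badly. Events of the second kind (`I₂`, `T₂`)
  -- put two conflicting `r`-sets into different blocks.
  let C : (Fin r → P) × (Fin r → P) → (Fin r → V) × (Fin r → V) → Prop := fun x a =>
    (∃ i j, i ≠ j ∧ (∀ s, (x.1 s).1 = i) ∧ ∀ s, (x.2 s).1 = j) ∧ Function.Injective x.1 ∧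
      Function.Injective x.2 ∧ R (univ.image a.1) (univ.image a.2)
  let I₁ := {x : Σ i, (Fin (sz i) → V) // Bad x.1 x.2}
  let I₂ := {x : ((Fin r → P) × (Fin r → P)) × ((Fin r → V) × (Fin r → V)) // C x.1 x.2}
  let T₁ : I₁ → Finset (P × V) := fun x => univ.image fun s => (⟨x.1.1, s⟩, x.1.2 s)
  let T₂ : I₂ → Finset (P × V) := fun x =>
    (univ.image fun s => (x.1.1.1 s, x.1.2.1 s)) ∪ univ.image fun s => (x.1.1.2 s, x.1.2.2 s)
  have hT₁ : ∀ x, #(T₁ x) = sz x.1.1 := by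
    intro x
    rw [card_image_of_injective, card_univ, Fintype.card_fin]
    intro s s' h
    have h1 : (⟨x.1.1, s⟩ : P) = ⟨x.1.1, s'⟩ := congrArg Prod.fst h
    exact eq_of_heq (Sigma.mk.inj h1).2
  have hT₂ : ∀ x, #(T₂ x) = 2 * r := by
    rintro ⟨⟨⟨x, y⟩, a, b⟩, ⟨i, j, hij, hx, hy⟩, hxi, hyi, -⟩
    rw [card_union_of_disjoint, card_image_of_injective, card_image_of_injective, card_univ,
      Fintype.card_fin, two_mul]
    · exact fun s s' h => hyi (congrArg Prod.fst h)
    · exact fun s s' h => hxi (congrArg Prod.fst h)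
    · rw [disjoint_left]
      intro z hz hz'
      obtain ⟨s, -, rfl⟩ := mem_image.1 hz
      obtain ⟨s', -, h⟩ := mem_image.1 hz'
      apply hij
      have : y s' = x s := congrArg Prod.fst h
      exact (hx s).symm.trans ((congrArg Sigma.fst this.symm).trans (hy s'))
  set n : ℝ := (Fintype.card V : ℝ) with hndef
  have hκ₁ : ∀ a b, ∑ x with (a, b) ∈ T₁ x, 1 / n ^ #(T₁ x) ≤ η / n := by
    rintro ⟨i, p⟩ v
    have hn0 : 0 < n := by
      rw [hndef]; exact_mod_cast Fintype.card_pos_iff.2 ⟨v⟩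
    have hmem : ∀ x : I₁, ((⟨i, p⟩ : P), v) ∈ T₁ x → ∃ τ : Fin (sz i) → V, x.1 = ⟨i, τ⟩ ∧
        τ p = v := by
      rintro ⟨⟨i', τ⟩, hbad⟩ hx
      obtain ⟨s, -, hs⟩ := mem_image.1 hx
      have h1 : (⟨i', s⟩ : Σ i, Fin (sz i)) = ⟨i, p⟩ := congrArg Prod.fst hs
      have h2 : τ s = v := congrArg Prod.snd hs
      cases h1
      exact ⟨τ, rfl, h2⟩
    have hcount : #{x : I₁ | ((⟨i, p⟩ : P), v) ∈ T₁ x} ≤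
        #{τ : Fin (sz i) → V | τ p = v ∧ Bad i τ} := by
      rw [← card_map (Function.Embedding.subtype _)]
      refine le_trans (card_le_card (t := ({τ : Fin (sz i) → V | τ p = v ∧ Bad i τ} :
        Finset _).image (Sigma.mk i)) ?_) card_image_le
      intro x hx
      obtain ⟨y, hy, rfl⟩ := mem_map.1 hx
      obtain ⟨τ, hτ, hv⟩ := hmem y (mem_filter.1 hy).2
      have hb := y.2
      rw [hτ] at hb
      exact mem_image.2 ⟨τ, mem_filter.2 ⟨mem_univ _, hv, hb⟩, hτ.symm⟩
    calc _ = ∑ x with ((⟨i, p⟩ : P), v) ∈ T₁ x, 1 / n ^ sz i := by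
          refine sum_congr rfl fun x hx => ?_
          obtain ⟨τ, hτ, -⟩ := hmem x (mem_filter.1 hx).2
          rw [hT₁, hτ]
      _ = #{x : I₁ | ((⟨i, p⟩ : P), v) ∈ T₁ x} * (1 / n ^ sz i) := by
          rw [sum_const, nsmul_eq_mul]
      _ ≤ (η * n ^ (sz i - 1)) * (1 / n ^ sz i) := by
          refine mul_le_mul_of_nonneg_right ?_ (by positivity)
          exact (Nat.cast_le.2 hcount).trans (hη i p v)
      _ = η / n := by
          obtain ⟨m, hm⟩ : ∃ m, sz i = m + 1 := ⟨sz i - 1, by have := hpos i; omega⟩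
          rw [hm, Nat.add_sub_cancel, pow_succ]
          field_simp
  have hκ₂ : ∀ a b, ∑ x with (a, b) ∈ T₂ x, 1 / n ^ #(T₂ x) ≤
      (2 * r ^ (r + 1) * B ^ (2 * r) * μ) / n := by
    intro p v
    have hn0 : 0 < n := by
      rw [hndef]; exact_mod_cast Fintype.card_pos_iff.2 ⟨v⟩
    -- `X` and `Y` contain the positions of the first and second `r`-set, `AB` their elements; the
    -- case that `p` is a position of the second set is reduced to the first by the swap `sw`
    let X : Finset (Fin r → P) := Fintype.piFinset fun _ => ({z | z.1 = p.1} : Finset P)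
    let Y : Finset (Fin r → P) := (univ : Finset (Fin q)).biUnion fun j =>
      Fintype.piFinset fun _ => ({z | z.1 = j} : Finset P)
    have hblock : ∀ j, #({z | z.1 = j} : Finset P) ≤ B := by
      intro j
      refine le_trans ?_ (hszB j)
      rw [← Fintype.card_fin (sz j), ← card_univ]
      refine le_trans (card_le_card (t := (univ : Finset (Fin (sz j))).image
        (fun s => (⟨j, s⟩ : P))) ?_) card_image_le
      rintro ⟨j', s⟩ hz
      obtain rfl : j' = j := (mem_filter.1 hz).2
      exact mem_image.2 ⟨s, mem_univ _, rfl⟩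
    have hpi : ∀ j, #(Fintype.piFinset fun _ : Fin r => ({z | z.1 = j} : Finset P)) ≤ B ^ r := by
      intro j
      rw [Fintype.card_piFinset, prod_const, card_univ, Fintype.card_fin]
      exact Nat.pow_le_pow_left (hblock j) _
    have hX : #X ≤ B ^ r := hpi _
    have hY : #Y ≤ Fintype.card V * B ^ r := by
      refine card_biUnion_le.trans ((sum_le_card_nsmul _ _ _ fun j _ => hpi j).trans ?_)
      rw [card_univ, Fintype.card_fin, smul_eq_mul]
      exact Nat.mul_le_mul_right _ hq
    let AB : Fin r → Finset ((Fin r → V) × (Fin r → V)) := fun s =>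
      {x | x.1 s = v ∧ R (univ.image x.1) (univ.image x.2)}
    have hAB : ∀ s, (#(AB s) : ℝ) ≤ n ^ (r - 1) * (r ^ r * (μ * n ^ (r - 1))) := fun s =>
      card_conflicting_tuples_le hsymm hcard hR s v
    let W : Fin r → Finset (((Fin r → P) × (Fin r → P)) × ((Fin r → V) × (Fin r → V))) :=
      fun s => (X ×ˢ Y) ×ˢ AB s
    let sw : (((Fin r → P) × (Fin r → P)) × ((Fin r → V) × (Fin r → V))) →
      (((Fin r → P) × (Fin r → P)) × ((Fin r → V) × (Fin r → V))) :=
      fun z => (z.1.swap, z.2.swap)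
    have hW : ∀ s, (#(W s) : ℝ) ≤ (B ^ r * (n * B ^ r)) *
        (n ^ (r - 1) * (r ^ r * (μ * n ^ (r - 1)))) := by
      intro s
      rw [card_product, card_product]
      push_cast
      have h1 : (#X : ℝ) ≤ (B : ℝ) ^ r := by exact_mod_cast hX
      have h2 : (#Y : ℝ) ≤ n * (B : ℝ) ^ r := by rw [hndef]; exact_mod_cast hY
      have h3 := hAB s
      gcongr
    have hmemW : ∀ x a s, C x a → x.1 s = p → a.1 s = v → (x, a) ∈ W s := by
      rintro ⟨x, y⟩ ⟨a, b⟩ s ⟨⟨i, j, -, hx, hy⟩, -, -, hRab⟩ hxs has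
      refine mem_product.2 ⟨mem_product.2 ⟨?_, ?_⟩, mem_filter.2 ⟨mem_univ _, has, hRab⟩⟩
      · refine Fintype.mem_piFinset.2 fun s' => mem_filter.2 ⟨mem_univ _, ?_⟩
        rw [← hxs]
        exact (hx s').trans (hx s).symm
      · exact mem_biUnion.2 ⟨j, mem_univ _, Fintype.mem_piFinset.2 fun s' =>
          mem_filter.2 ⟨mem_univ _, hy s'⟩⟩
    have hCsw : ∀ x a, C x a → C x.swap a.swap := by
      rintro ⟨x, y⟩ ⟨a, b⟩ ⟨⟨i, j, hij, hx, hy⟩, hxi, hyi, hRab⟩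
      exact ⟨⟨j, i, hij.symm, hy, hx⟩, hyi, hxi, hsymm _ _ hRab⟩
    have hcount : #{x : I₂ | (p, v) ∈ T₂ x} ≤ ∑ s : Fin r, (#(W s) + #(W s)) := by
      rw [← card_map (Function.Embedding.subtype _)]
      refine le_trans (card_le_card (t := univ.biUnion fun s => W s ∪ (W s).image sw) ?_)
        (card_biUnion_le.trans (sum_le_sum fun s _ => (card_union_le _ _).trans
          (Nat.add_le_add_left card_image_le _)))
      intro z hz
      obtain ⟨⟨⟨x, a⟩, hC⟩, hy, rfl⟩ := mem_map.1 hz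
      rcases mem_union.1 (mem_filter.1 hy).2 with h | h
      · obtain ⟨s, -, hs⟩ := mem_image.1 h
        exact mem_biUnion.2 ⟨s, mem_univ _, mem_union_left _
          (hmemW x a s hC (congrArg Prod.fst hs) (congrArg Prod.snd hs))⟩
      · obtain ⟨s, -, hs⟩ := mem_image.1 h
        refine mem_biUnion.2 ⟨s, mem_univ _, mem_union_right _ (mem_image.2
          ⟨(x.swap, a.swap), ?_, ?_⟩)⟩
        · exact hmemW x.swap a.swap s (hCsw _ _ hC) (congrArg Prod.fst hs) (congrArg Prod.snd hs)
        · simp [sw]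
    calc _ = ∑ x with (p, v) ∈ T₂ x, 1 / n ^ (2 * r) :=
          sum_congr rfl fun x _ => by rw [hT₂]
      _ = #{x : I₂ | (p, v) ∈ T₂ x} * (1 / n ^ (2 * r)) := by
          rw [sum_const, nsmul_eq_mul]
      _ ≤ (∑ s : Fin r, (2 * ((B ^ r * (n * B ^ r)) *
            (n ^ (r - 1) * (r ^ r * (μ * n ^ (r - 1))))))) * (1 / n ^ (2 * r)) := by
          refine mul_le_mul_of_nonneg_right ?_ (by positivity)
          refine (Nat.cast_le.2 hcount).trans ?_
          push_cast
          refine sum_le_sum fun s _ => ?_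
          have := hW s
          linarith
      _ = _ := by
          rw [sum_const, card_univ, Fintype.card_fin, nsmul_eq_mul]
          obtain ⟨m, rfl⟩ : ∃ m, r = m + 1 := ⟨r - 1, by omega⟩
          rw [Nat.add_sub_cancel]
          field_simp
          ring
  obtain ⟨σ, hσ⟩ := exists_equiv_forall_not_extends hPV (Sum.elim T₁ T₂) (B := B)
    (κ := η + 2 * r ^ (r + 1) * B ^ (2 * r) * μ)
    (by
      rintro (x | x)
      · rw [← card_pos]
        simp only [Sum.elim_inl, hT₁]
        exact hpos _
      · rw [← card_pos]
        simp only [Sum.elim_inr, hT₂]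
        omega)
    (by
      rintro (x | x)
      · simp only [Sum.elim_inl, hT₁]
        exact hszB _
      · simp only [Sum.elim_inr, hT₂]
        exact hrB)
    hn
    (by
      intro a b
      rw [sum_filter, Fintype.sum_sum_type, add_div]
      refine add_le_add (le_trans (le_of_eq ?_) (hκ₁ a b)) (le_trans (le_of_eq ?_) (hκ₂ a b))
      · rw [sum_filter]; exact sum_congr rfl fun x _ => by congr
      · rw [sum_filter]; exact sum_congr rfl fun x _ => by congr)
    hsmall
  refine ⟨σ, fun i hbad => ?_, ?_⟩
  · refine hσ (Sum.inl ⟨⟨i, fun s => σ ⟨i, s⟩⟩, hbad⟩) fun x hx => ?_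
    obtain ⟨s, -, rfl⟩ := mem_image.1 hx
    rfl
  · intro i j hij e he f hf hRef
    let ae := (equivFinOfCardEq (hcard e f hRef)).symm
    let af := (equivFinOfCardEq (hcard f e (hsymm _ _ hRef))).symm
    have himg : ∀ (g : Finset V) (α : Fin r ≃ g), univ.image (fun s => (α s : V)) = g := by
      intro g α
      ext x
      simp only [mem_image, mem_univ, true_and]
      exact ⟨by rintro ⟨s, rfl⟩; exact (α s).2, fun hx => ⟨α.symm ⟨x, hx⟩, by simp⟩⟩
    have hloc : ∀ (g : Finset V) (l : Fin q), g ⊆ univ.image (fun s => σ ⟨l, s⟩) → ∀ x ∈ g,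
        (σ.symm x).1 = l := by
      intro g l hg x hx
      obtain ⟨s, -, rfl⟩ := mem_image.1 (hg hx)
      simp
    refine hσ (Sum.inr ⟨((fun s => σ.symm (ae s), fun s => σ.symm (af s)),
      (fun s => (ae s : V), fun s => (af s : V))), ⟨i, j, hij, fun s => hloc e i he _ (ae s).2,
        fun s => hloc f j hf _ (af s).2⟩, ?_, ?_, ?_⟩) ?_
    · exact σ.symm.injective.comp (Subtype.val_injective.comp ae.injective)
    · exact σ.symm.injective.comp (Subtype.val_injective.comp af.injective)
    · change R (univ.image fun s => (ae s : V)) (univ.image fun s => (af s : V))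
      rwa [himg, himg]
    · intro x hx
      rcases mem_union.1 hx with h | h
      · obtain ⟨s, -, rfl⟩ := mem_image.1 h
        simp
      · obtain ⟨s, -, rfl⟩ := mem_image.1 h
        simp

/-! ### Factors in small sets of vertices -/

namespace RGraph

section Copy

variable {r : ℕ} {U : Type u} {V : Type v} {W : Type w} [Fintype U]

theorem Copy.card_verts {H : RGraph r U} {G : RGraph r V} (K : Copy H G) :
    K.verts.card = Fintype.card U := by
  obtain ⟨f, hf, -⟩ := K.exists_iso
  rw [hf, Finset.card_map, Finset.card_univ]

theorem Copy.subset_verts {H : RGraph r U} {G : RGraph r V} (K : Copy H G) {e : Finset V}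
    (he : e ∈ K.edges) : e ⊆ K.verts := by
  obtain ⟨f, hf, hf'⟩ := K.exists_iso
  rw [hf'] at he
  obtain ⟨e', -, rfl⟩ := Finset.mem_map.1 he
  rw [hf]
  exact Finset.map_subset_map.2 (Finset.subset_univ _)

/-- The image of a copy of `H` under an embedding of one `r`-graph into another. -/
def Copy.map {H : RGraph r U} {G' : RGraph r W} {G : RGraph r V} (φ : W ↪ V)
    (hφ : ∀ e ∈ G'.edges, e.map φ ∈ G.edges) (K : Copy H G') : Copy H G where
  verts := K.verts.map φ
  edges := K.edges.map (Finset.mapEmbedding φ).toEmbedding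
  edges_subset := by
    intro e he
    obtain ⟨e', he', rfl⟩ := Finset.mem_map.1 he
    exact hφ e' (K.edges_subset he')
  exists_iso := by
    obtain ⟨f, hf, hf'⟩ := K.exists_iso
    refine ⟨f.trans φ, ?_, ?_⟩
    · rw [hf, Finset.map_map]
    · rw [hf', Finset.map_map]
      congr 1
      ext e x
      simp

theorem Copy.map_injective {H : RGraph r U} {G' : RGraph r W} {G : RGraph r V} (φ : W ↪ V)
    (hφ : ∀ e ∈ G'.edges, e.map φ ∈ G.edges) :
    Function.Injective (Copy.map (H := H) φ hφ) := by
  rintro ⟨v, E, h1, h2⟩ ⟨v', E', h1', h2'⟩ h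
  obtain ⟨hv, hE⟩ := (Copy.mk.injEq ..).mp h
  obtain rfl := Finset.map_injective _ hv
  obtain rfl := Finset.map_injective _ hE
  rfl

end Copy

open Finset in
/-- If all `r`-graphs on `M` vertices with minimum degree above `D` have an `H`-factor, then there
is an `H`-factor inside each set of `M` vertices in which the degrees are above `D`. -/
theorem exists_factor_inside {r ℓ M : ℕ} {U : Type u} [Fintype U] {V : Type v} [DecidableEq V]
    {H : RGraph r U} {G : RGraph r V} {D : ℝ} (hℓM : ℓ ≤ M)
    (hM : ∀ G' : RGraph r (Fin M), D < G'.minDegree ℓ → ∃ F : Finset (Copy H G'), IsFactor F)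
    {S : Finset V} (hS : #S = M) (hdeg : ∀ L ⊆ S, #L = ℓ → D < #(G.edgesIn L S)) :
    ∃ F : Finset (Copy H G), IsPartialFactor F ∧ (∀ K ∈ F, K.verts ⊆ S) ∧
      #F * Fintype.card U = M := by
  classical
  let φ : Fin M ↪ V := (equivFinOfCardEq hS).symm.toEmbedding.trans (Function.Embedding.subtype _)
  have hφS : ∀ i, φ i ∈ S := fun i => ((equivFinOfCardEq hS).symm i).2
  have hφ : ∀ e ⊆ S, (univ.filter fun i => φ i ∈ e).map φ = e := by
    intro e he
    ext x
    simp only [Finset.mem_map, mem_filter, mem_univ, true_and]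
    constructor
    · rintro ⟨i, hi, rfl⟩
      exact hi
    · intro hx
      refine ⟨equivFinOfCardEq hS ⟨x, he hx⟩, ?_, ?_⟩ <;> simp [φ, hx]
  let G' : RGraph r (Fin M) :=
    ⟨univ.filter fun e => e.map φ ∈ G.edges, fun e he => by
      rw [← card_map φ]
      exact G.card_eq _ (mem_filter.1 he).2⟩
  have hG' : ∀ e ∈ G'.edges, e.map φ ∈ G.edges := fun e he => (mem_filter.1 he).2
  have hmin : D < G'.minDegree ℓ := by
    have hne : {d : ℕ | ∃ L : Finset (Fin M), #L = ℓ ∧ G'.degree L = d}.Nonempty := by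
      obtain ⟨L, -, hL⟩ := exists_subset_card_eq (s := (univ : Finset (Fin M))) (n := ℓ)
        (by simpa using hℓM)
      exact ⟨_, L, hL, rfl⟩
    obtain ⟨L, hL, hLd⟩ := Nat.sInf_mem hne
    have hLS : L.map φ ⊆ S := by
      intro x hx
      obtain ⟨i, -, rfl⟩ := Finset.mem_map.1 hx
      exact hφS i
    have h1 := hdeg (L.map φ) hLS (by rw [card_map, hL])
    have h2 : #(G.edgesIn (L.map φ) S) ≤ G'.degree L := by
      rw [degree, ← card_map (mapEmbedding φ).toEmbedding]
      refine card_le_card fun e he => ?_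
      obtain ⟨heG, hLe, heS⟩ := mem_edgesIn.1 he
      refine Finset.mem_map.2 ⟨univ.filter fun i => φ i ∈ e, mem_filter.2 ⟨mem_filter.2
        ⟨mem_univ _, ?_⟩, ?_⟩, hφ e heS⟩
      · rwa [hφ e heS]
      · intro i hi
        exact mem_filter.2 ⟨mem_univ _, hLe (mem_map_of_mem φ hi)⟩
    rw [minDegree, ← hLd]
    exact h1.trans_le (by exact_mod_cast h2)
  obtain ⟨F, hFp, hFc⟩ := hM G' hmin
  refine ⟨F.map ⟨Copy.map φ hG', Copy.map_injective φ hG'⟩, ?_, ?_, ?_⟩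
  · intro K hK K' hK' hne
    obtain ⟨K, hL, rfl⟩ := Finset.mem_map.1 (mem_coe.1 hK)
    obtain ⟨K', hL', rfl⟩ := Finset.mem_map.1 (mem_coe.1 hK')
    have : Disjoint K.verts K'.verts := hFp hL hL' fun h => hne (by rw [h])
    exact (disjoint_map φ).2 this
  · intro K hK
    obtain ⟨K, -, rfl⟩ := Finset.mem_map.1 hK
    intro x hx
    obtain ⟨i, -, rfl⟩ := Finset.mem_map.1 hx
    exact hφS i
  · rw [card_map, hFc, Fintype.card_fin]

open Finset in
/-- Passing to a subset `S'` of `S` loses few edges at `L`: a lost edge contains a further vertex in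
`S \ S'`, and its remaining `k - 1` vertices are in `S`. -/
theorem card_edgesIn_le_add {r ℓ k : ℕ} {V : Type v} [DecidableEq V] (G : RGraph r V)
    (hr : ℓ + k = r) {L S' S : Finset V} (hL : #L = ℓ) (hLS : L ⊆ S') :
    #(G.edgesIn L S) ≤ #(G.edgesIn L S') + #(S \ S') * #S ^ (k - 1) := by
  have hsub : G.edgesIn L S ⊆ G.edgesIn L S' ∪
      (S \ S').biUnion fun x => (G.edgesIn L S).filter fun e => x ∈ e := by
    intro e he
    obtain ⟨heG, hLe, heS⟩ := mem_edgesIn.1 he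
    by_cases h : e ⊆ S'
    · exact mem_union_left _ (mem_edgesIn.2 ⟨heG, hLe, h⟩)
    · obtain ⟨x, hx, hx'⟩ := not_subset.1 h
      exact mem_union_right _ (mem_biUnion.2 ⟨x, Finset.mem_sdiff.2 ⟨heS hx, hx'⟩,
        mem_filter.2 ⟨he, hx⟩⟩)
  refine (card_le_card hsub).trans ((card_union_le _ _).trans (Nat.add_le_add_left ?_ _))
  refine card_biUnion_le.trans ((sum_le_card_nsmul _ _ (#S ^ (k - 1)) fun x hx => ?_).trans
    (by rw [smul_eq_mul]))
  have hxL : x ∉ L := fun h => (Finset.mem_sdiff.1 hx).2 (hLS h)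
  refine le_trans (card_le_card_of_injOn (t := powersetCard (k - 1) S)
    (fun e => e \ insert x L) ?_ ?_) ?_
  · intro e he
    obtain ⟨he, hxe⟩ := mem_filter.1 (mem_coe.1 he)
    obtain ⟨heG, hLe, heS⟩ := mem_edgesIn.1 he
    refine mem_coe.2 (mem_powersetCard.2 ⟨sdiff_subset.trans heS, ?_⟩)
    rw [card_sdiff_of_subset (insert_subset hxe hLe), card_insert_of_notMem hxL, hL,
      G.card_eq e heG]
    omega
  · intro e he e' he' h
    obtain ⟨he, hxe⟩ := mem_filter.1 (mem_coe.1 he)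
    obtain ⟨-, hLe, -⟩ := mem_edgesIn.1 he
    obtain ⟨he', hxe'⟩ := mem_filter.1 (mem_coe.1 he')
    obtain ⟨-, hLe', -⟩ := mem_edgesIn.1 he'
    rw [← sdiff_union_of_subset (insert_subset hxe hLe),
      ← sdiff_union_of_subset (insert_subset hxe' hLe')]
    exact congrArg (· ∪ insert x L) h
  · rw [card_powersetCard]
    exact Nat.choose_le_pow _ _

open Finset in
/-- If all `r`-graphs on `M` vertices with minimum degree above `D` have an `H`-factor, then sets of
`M` or `M + h` vertices with slightly larger degrees contain an `H`-factor. In the second case one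
copy of `H` is found in some `M` of the vertices, and an `H`-factor in the `M` vertices outside
that copy. -/
theorem exists_factor_inside_of_card {r ℓ k M : ℕ} {U : Type u} [Fintype U] {V : Type v}
    [DecidableEq V] {H : RGraph r U} {G : RGraph r V} {D D' : ℝ} (hr : ℓ + k = r) (hM0 : 0 < M)
    (hU : 0 < Fintype.card U) (hℓM : ℓ ≤ M)
    (hM : ∀ G' : RGraph r (Fin M), D < G'.minDegree ℓ → ∃ F : Finset (Copy H G'), IsFactor F)
    (hD : D + Fintype.card U * ((M + Fintype.card U : ℕ) : ℝ) ^ (k - 1) < D')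
    {S : Finset V} (hS : #S = M ∨ #S = M + Fintype.card U) (hdeg : G.HasMinDegreeOn ℓ D' S) :
    ∃ F : Finset (Copy H G), IsPartialFactor F ∧ (∀ K ∈ F, K.verts ⊆ S) ∧
      #F * Fintype.card U = #S := by
  classical
  rcases hS with hS | hS
  · rw [hS]
    refine exists_factor_inside hℓM hM hS fun L hLS hL => lt_of_lt_of_le ?_ (hdeg L hLS hL)
    have : (0 : ℝ) ≤ Fintype.card U * ((M + Fintype.card U : ℕ) : ℝ) ^ (k - 1) := by positivity
    linarith
  · have hsub : ∀ S' ⊆ S, #S' = M → ∃ F : Finset (Copy H G), IsPartialFactor F ∧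
        (∀ K ∈ F, K.verts ⊆ S') ∧ #F * Fintype.card U = M := by
      intro S' hS'S hS'
      refine exists_factor_inside hℓM hM hS' fun L hLS hL => ?_
      have h1 := hdeg L (hLS.trans hS'S) hL
      have h2 := card_edgesIn_le_add G hr (S := S) hL hLS
      rw [card_sdiff_of_subset hS'S, hS, hS', Nat.add_sub_cancel_left] at h2
      have h3 : (#(G.edgesIn L S) : ℝ) ≤ #(G.edgesIn L S') +
          Fintype.card U * ((M + Fintype.card U : ℕ) : ℝ) ^ (k - 1) := by exact_mod_cast h2
      linarith
    obtain ⟨S₀, hS₀S, hS₀⟩ := exists_subset_card_eq (s := S) (n := M) (by omega)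
    obtain ⟨F₀, -, hF₀S, hF₀⟩ := hsub S₀ hS₀S hS₀
    obtain ⟨K₀, hK₀⟩ : F₀.Nonempty := by
      rw [← card_pos]
      exact Nat.pos_of_mul_pos_right (hF₀ ▸ hM0)
    have hK₀S : K₀.verts ⊆ S := (hF₀S K₀ hK₀).trans hS₀S
    obtain ⟨F₁, hF₁p, hF₁S, hF₁⟩ := hsub (S \ K₀.verts) sdiff_subset (by
      rw [card_sdiff_of_subset hK₀S, hS, K₀.card_verts, Nat.add_sub_cancel])
    have hdisj : ∀ K ∈ F₁, Disjoint K₀.verts K.verts := fun K hK =>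
      disjoint_sdiff.mono_right (hF₁S K hK)
    have hK₀F₁ : K₀ ∉ F₁ := by
      intro h
      have h1 := hdisj K₀ h
      rw [disjoint_self, bot_eq_empty] at h1
      have h2 := K₀.card_verts
      rw [h1, card_empty] at h2
      omega
    refine ⟨insert K₀ F₁, ?_, ?_, ?_⟩
    · rw [IsPartialFactor, coe_insert]
      exact Set.PairwiseDisjoint.insert hF₁p fun K hK _ => hdisj K hK
    · intro K hK
      rcases mem_insert.1 hK with rfl | hK
      · exact hK₀S
      · exact (hF₁S K hK).trans sdiff_subset
    · rw [card_insert_of_notMem hK₀F₁, add_mul, one_mul, hF₁, hS]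

/-! ### The threshold for factors -/

open Finset in
theorem minDegree_le_pow {r ℓ k n : ℕ} (hr : ℓ + k = r) (G : RGraph r (Fin n)) :
    G.minDegree ℓ ≤ n ^ k := by
  by_cases hℓ : ℓ ≤ n
  · obtain ⟨L, -, hL⟩ := exists_subset_card_eq (s := (univ : Finset (Fin n))) (n := ℓ)
      (by simpa using hℓ)
    have h0 : G.minDegree ℓ ≤ G.degree L := Nat.sInf_le ⟨L, hL, rfl⟩
    refine h0.trans ?_
    refine le_trans (card_le_card_of_injOn (t := powersetCard k univ)
      (fun e => e \ L) ?_ ?_) ?_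
    · intro e he
      obtain ⟨heG, hLe⟩ := mem_filter.1 (mem_coe.1 he)
      refine mem_coe.2 (mem_powersetCard.2 ⟨subset_univ _, ?_⟩)
      rw [card_sdiff_of_subset hLe, hL, G.card_eq e heG]
      omega
    · intro e he e' he' h
      obtain ⟨-, hLe⟩ := mem_filter.1 (mem_coe.1 he)
      obtain ⟨-, hLe'⟩ := mem_filter.1 (mem_coe.1 he')
      rw [← sdiff_union_of_subset hLe, ← sdiff_union_of_subset hLe']
      exact congrArg (· ∪ L) h
    · rw [card_powersetCard, card_univ, Fintype.card_fin]
      exact Nat.choose_le_pow _ _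
  · have : {d : ℕ | ∃ L : Finset (Fin n), #L = ℓ ∧ G.degree L = d} = ∅ := by
      rw [Set.eq_empty_iff_forall_notMem]
      rintro d ⟨L, hL, -⟩
      have := card_le_univ L
      rw [Fintype.card_fin] at this
      omega
    rw [minDegree, this, Nat.sInf_empty]
    exact Nat.zero_le _

section Threshold

variable {r : ℕ} {U : Type u} [Fintype U] (ℓ : ℕ) (H : RGraph r U) (n : ℕ)

theorem bddBelow_factorThreshold :
    BddBelow {δ : ℝ | 0 ≤ δ ∧ ∀ G : RGraph r (Fin n),
      δ * (n : ℝ) ^ (r - ℓ) < (G.minDegree ℓ : ℝ) → ∃ F : Finset (Copy H G), IsFactor F} :=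
  ⟨0, fun _ h => h.1⟩

theorem one_mem_factorThreshold (hr : ℓ ≤ r) :
    (1 : ℝ) ∈ {δ : ℝ | 0 ≤ δ ∧ ∀ G : RGraph r (Fin n),
      δ * (n : ℝ) ^ (r - ℓ) < (G.minDegree ℓ : ℝ) → ∃ F : Finset (Copy H G), IsFactor F} := by
  refine ⟨zero_le_one, fun G hG => ?_⟩
  have h1 := minDegree_le_pow (ℓ := ℓ) (k := r - ℓ) (by omega) G
  have h2 : (G.minDegree ℓ : ℝ) ≤ (n : ℝ) ^ (r - ℓ) := by exact_mod_cast h1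
  linarith

theorem factorThresholdAt_nonneg : 0 ≤ factorThresholdAt ℓ H n :=
  Real.sInf_nonneg fun _ h => h.1

theorem factorThresholdAt_le_one (hr : ℓ ≤ r) : factorThresholdAt ℓ H n ≤ 1 :=
  csInf_le (bddBelow_factorThreshold ℓ H n) (one_mem_factorThreshold ℓ H n hr)

theorem isBoundedUnder_factorThresholdAt :
    IsBoundedUnder (· ≥ ·) atTop fun m : ℕ => factorThresholdAt ℓ H (m * Fintype.card U) :=
  isBoundedUnder_of ⟨0, fun _ => factorThresholdAt_nonneg ℓ H _⟩

theorem isCoboundedUnder_factorThresholdAt (hr : ℓ ≤ r) :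
    IsCoboundedUnder (· ≥ ·) atTop fun m : ℕ => factorThresholdAt ℓ H (m * Fintype.card U) :=
  (isBoundedUnder_of ⟨1, fun _ => factorThresholdAt_le_one ℓ H _ hr⟩ :
    IsBoundedUnder (· ≤ ·) atTop _).isCoboundedUnder_ge

theorem factorThreshold_nonneg (hr : ℓ ≤ r) : 0 ≤ factorThreshold ℓ H :=
  le_liminf_of_le (isCoboundedUnder_factorThresholdAt ℓ H hr)
    (Eventually.of_forall fun _ => factorThresholdAt_nonneg ℓ H _)

variable {ℓ H}

theorem frequently_exists_factor (hr : ℓ ≤ r) {δ : ℝ} (hδ : factorThreshold ℓ H < δ) :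
    ∃ᶠ m : ℕ in atTop, ∀ G : RGraph r (Fin (m * Fintype.card U)),
      δ * ((m * Fintype.card U : ℕ) : ℝ) ^ (r - ℓ) < (G.minDegree ℓ : ℝ) →
        ∃ F : Finset (Copy H G), IsFactor F := by
  refine (frequently_lt_of_liminf_lt (isCoboundedUnder_factorThresholdAt ℓ H hr) hδ).mono ?_
  intro m hm G hG
  obtain ⟨δ', ⟨-, hδ'⟩, hlt⟩ := exists_lt_of_csInf_lt ⟨1, one_mem_factorThreshold ℓ H _ hr⟩ hm
  refine hδ' G (lt_of_le_of_lt ?_ hG)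
  gcongr

theorem eventually_exists_no_factor {δ : ℝ} (hδ0 : 0 ≤ δ) (hδ : δ < factorThreshold ℓ H) :
    ∀ᶠ m : ℕ in atTop, ∃ G : RGraph r (Fin (m * Fintype.card U)),
      δ * ((m * Fintype.card U : ℕ) : ℝ) ^ (r - ℓ) < (G.minDegree ℓ : ℝ) ∧
        ¬ ∃ F : Finset (Copy H G), IsFactor F := by
  filter_upwards [eventually_lt_of_lt_liminf hδ (isBoundedUnder_factorThresholdAt ℓ H)] with m hm
  by_contra hcon
  push Not at hcon
  exact absurd (csInf_le (bddBelow_factorThreshold ℓ H _) ⟨hδ0, hcon⟩) (not_le.2 hm)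

end Threshold

end RGraph

/-! ### Choice of the block sizes and of the constants -/

/-- Bernoulli's inequality for `(b - t) ^ k`. -/
theorem pow_mul_one_sub_le (k : ℕ) {t b : ℕ} (hb : 0 < b) (htb : t ≤ b) :
    (b : ℝ) ^ k * (1 - k * (t / b)) ≤ ((b - t : ℕ) : ℝ) ^ k := by
  have hb' : (0 : ℝ) < b := by exact_mod_cast hb
  have h1 : (t : ℝ) / b ≤ 1 := by
    rw [div_le_one hb']; exact_mod_cast htb
  have h2 := one_add_mul_le_pow (a := -((t : ℝ) / b)) (by linarith) k
  have h3 : ((b - t : ℕ) : ℝ) = b * (1 + -((t : ℝ) / b)) := by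
    rw [Nat.cast_sub htb]
    field_simp
    ring
  rw [h3, mul_pow]
  refine mul_le_mul_of_nonneg_left ?_ (by positivity)
  linarith

theorem eventually_pow_le_two_mul_descFactorial (B : ℕ) :
    ∀ᶠ n : ℕ in atTop, ∀ d ≤ B, (n : ℝ) ^ d ≤ 2 * n.descFactorial d := by
  filter_upwards [eventually_ge_atTop (2 * B * B + 1 + B)] with n hn d hd
  have hn0 : 0 < n := by omega
  have hn0' : (0 : ℝ) < n := by exact_mod_cast hn0
  have h1 := pow_mul_one_sub_le d hn0 (show d ≤ n by omega)
  have h2 : ((n - d : ℕ) : ℝ) ^ d ≤ n.descFactorial d := by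
    have := Nat.pow_sub_le_descFactorial n d
    have h3 : (n - d) ^ d ≤ (n + 1 - d) ^ d := Nat.pow_le_pow_left (by omega) _
    exact_mod_cast h3.trans this
  have h4 : (d : ℝ) * (d / n) ≤ 1 / 2 := by
    rw [mul_div_assoc', div_le_iff₀ hn0']
    have h5 : (d : ℝ) ≤ B := by exact_mod_cast hd
    have h6 : (2 * B * B + 1 + B : ℝ) ≤ n := by exact_mod_cast hn
    have h7 : (d : ℝ) * d ≤ B * B := by gcongr
    have h8 : (0 : ℝ) ≤ B := by positivity
    linarith
  have h9 : (n : ℝ) ^ d * (1 / 2) ≤ (n : ℝ) ^ d * (1 - d * (d / n)) := by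
    refine mul_le_mul_of_nonneg_left ?_ (by positivity)
    linarith
  linarith

theorem eventually_degree_bound (ℓ k : ℕ) {δ ε : ℝ} (hδ : 0 ≤ δ) (hε : 0 < ε) :
    ∀ᶠ b : ℕ in atTop, ∀ d ≤ b, b ≤ d + ℓ + 1 →
      k.factorial * ((δ + ε / 2) * (b : ℝ) ^ k) ≤
        k.factorial * (δ + ε) * d.descFactorial k - ε / 4 * (d : ℝ) ^ k := by
  filter_upwards [eventually_ge_atTop (ℓ + 1 + k + 1),
    eventually_ge_atTop ⌈4 * ((δ + ε) * k * (ℓ + 1 + k : ℕ)) / ε⌉₊] with b hb hb2 d hdb hbd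
  have hb0 : 0 < b := by omega
  have hb0' : (0 : ℝ) < b := by exact_mod_cast hb0
  have h1 := pow_mul_one_sub_le k hb0 (show ℓ + 1 + k ≤ b by omega)
  have h2 : ((b - (ℓ + 1 + k) : ℕ) : ℝ) ^ k ≤ d.descFactorial k := by
    have := Nat.pow_sub_le_descFactorial d k
    have h3 : (b - (ℓ + 1 + k)) ^ k ≤ (d + 1 - k) ^ k := Nat.pow_le_pow_left (by omega) _
    exact_mod_cast h3.trans this
  have h3 : (δ + ε) * (k * ((ℓ + 1 + k : ℕ) / b)) ≤ ε / 4 := by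
    have h4 := Nat.ceil_le.1 hb2
    rw [div_le_iff₀ hε] at h4
    have h5 : (δ + ε) * (k * (((ℓ + 1 + k : ℕ) : ℝ) / b)) =
        (δ + ε) * k * (ℓ + 1 + k : ℕ) / b := by ring
    rw [h5, div_le_iff₀ hb0']
    linarith
  have h4 : (δ + 3 * ε / 4) * (b : ℝ) ^ k ≤ (δ + ε) * d.descFactorial k := by
    calc _ ≤ (δ + ε - (δ + ε) * (k * ((ℓ + 1 + k : ℕ) / b))) * (b : ℝ) ^ k := by
          gcongr
          linarith
      _ = (δ + ε) * ((b : ℝ) ^ k * (1 - k * ((ℓ + 1 + k : ℕ) / b))) := by ring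
      _ ≤ _ := by
          gcongr
          exact h1.trans h2
  have h5 : ε / 4 * (d : ℝ) ^ k ≤ k.factorial * (ε / 4 * (b : ℝ) ^ k) := by
    have h6 : (1 : ℝ) ≤ k.factorial := by exact_mod_cast k.factorial_pos
    have h7 : (d : ℝ) ≤ b := by exact_mod_cast hdb
    calc ε / 4 * (d : ℝ) ^ k ≤ 1 * (ε / 4 * (b : ℝ) ^ k) := by rw [one_mul]; gcongr
      _ ≤ _ := by gcongr
  have h8 := mul_le_mul_of_nonneg_left h4 (Nat.cast_nonneg (α := ℝ) k.factorial)
  linarith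

theorem eventually_pow_mul_exp_neg_le (ℓ : ℕ) {c η : ℝ} (hc : 0 < c) (hη : 0 < η) :
    ∀ᶠ b : ℕ in atTop, (b : ℝ) ^ (ℓ + 1) * Real.exp (-(c * (b - ℓ - 1 : ℝ))) ≤ η := by
  have h1 := (Real.tendsto_pow_mul_exp_neg_atTop_nhds_zero (ℓ + 1)).comp
    (tendsto_natCast_atTop_atTop.const_mul_atTop hc)
  have h2 := h1.const_mul (Real.exp (c * (ℓ + 1)) / c ^ (ℓ + 1))
  rw [mul_zero] at h2
  filter_upwards [h2.eventually_le_const hη] with b hb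
  refine le_trans (le_of_eq ?_) hb
  simp only [Function.comp]
  have h3 : -(c * (b - ℓ - 1 : ℝ)) = c * (ℓ + 1) + -(c * b) := by ring
  rw [h3, Real.exp_add, mul_pow]
  field_simp

/-- Every large multiple of `h` is a sum of terms `m h` and `m h + h`: write `n / h = a m + s` with
`s < m ≤ a`, and use `s` terms of the second kind. -/
theorem exists_block_sizes {m h n : ℕ} (hm : 0 < m) (hh : 0 < h) (hhn : h ∣ n)
    (hn : m * m * h ≤ n) :
    ∃ (q : ℕ) (sz : Fin q → ℕ), (∀ i, sz i = m * h ∨ sz i = m * h + h) ∧ ∑ i, sz i = n := by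
  obtain ⟨N, rfl⟩ := hhn
  have hN : m * m ≤ N := by
    rw [mul_comm h N] at hn
    exact Nat.le_of_mul_le_mul_right hn hh
  have hlt := Nat.mod_lt N hm
  have hdiv : N % m ≤ N / m := hlt.le.trans ((Nat.le_div_iff_mul_le hm).2 hN)
  refine ⟨(N / m - N % m) + N % m, Fin.append (fun _ => m * h) (fun _ => m * h + h), ?_, ?_⟩
  · intro i
    refine Fin.addCases (fun i => ?_) (fun i => ?_) i
    · left; simp
    · right; simp
  · rw [Fin.sum_univ_add]
    simp only [Fin.append_left, Fin.append_right, Finset.sum_const, Finset.card_univ,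
      Fintype.card_fin, smul_eq_mul]
    obtain ⟨a, ha⟩ := Nat.exists_eq_add_of_le hdiv
    rw [ha, Nat.add_sub_cancel_left]
    have := Nat.div_add_mod N m
    rw [ha] at this
    generalize N % m = s at *
    rw [← this]
    ring

/-! ### Rainbow factors -/

namespace RGraph

/-- Two sets of vertices are edges of the same colour. -/
def SameColour {r : ℕ} {V : Type v} {G : RGraph r V} {C : Type w}
    (c : {e : Finset V // e ∈ G.edges} → C) (e f : Finset V) : Prop :=
  ∃ (he : e ∈ G.edges) (hf : f ∈ G.edges), c ⟨e, he⟩ = c ⟨f, hf⟩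

section SameColour

variable {r : ℕ} {V : Type v} {G : RGraph r V} {C : Type w}
  {c : {e : Finset V // e ∈ G.edges} → C}

theorem SameColour.symm {e f : Finset V} (h : SameColour c e f) : SameColour c f e := by
  obtain ⟨he, hf, h⟩ := h
  exact ⟨hf, he, h.symm⟩

theorem SameColour.card_eq {e f : Finset V} (h : SameColour c e f) : e.card = r :=
  G.card_eq e h.1

open Finset in
open scoped Classical in
theorem card_sameColour_le [Fintype V] {μ : ℝ} (hμ : 0 ≤ μ) (hc : G.IsBounded c μ) (e : Finset V) :
    (#{f | SameColour c e f} : ℝ) ≤ μ * (Fintype.card V : ℝ) ^ (r - 1) := by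
  by_cases he : e ∈ G.edges
  · refine le_trans (Nat.cast_le.2 ?_) (hc (c ⟨e, he⟩)).1
    rw [← Set.ncard_image_of_injective _ Subtype.val_injective, ← Set.ncard_coe_finset]
    refine Set.ncard_le_ncard ?_ (Set.toFinite _)
    intro f hf
    obtain ⟨_, hfG, h⟩ := (mem_filter.1 (mem_coe.1 hf)).2
    exact ⟨⟨f, hfG⟩, h.symm, rfl⟩
  · have : ({f | SameColour c e f} : Finset (Finset V)) = ∅ := by
      rw [filter_eq_empty_iff]
      rintro f - ⟨h, -⟩
      exact he h
    rw [this]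
    simp only [card_empty, Nat.cast_zero]
    positivity

open Finset in
open scoped Classical in
theorem card_sameColour_insert_le [Fintype V] [DecidableEq V] {μ : ℝ} (hμ : 0 ≤ μ)
    (hr : 0 < r) (hc : G.IsBounded c μ) (e I : Finset V) (hI : #I = r - 1) :
    (#{x | SameColour c e (insert x I)} : ℝ) ≤ μ * Fintype.card V := by
  by_cases he : e ∈ G.edges
  · refine le_trans (Nat.cast_le.2 ?_) ((hc (c ⟨e, he⟩)).2 I hI)
    rw [← Set.ncard_image_of_injective _ Subtype.val_injective, ← Set.ncard_coe_finset]
    refine Set.ncard_le_ncard_of_injOn (fun x => insert x I) ?_ ?_ (Set.toFinite _)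
    · intro x hx
      obtain ⟨_, hfG, h⟩ := (mem_filter.1 (mem_coe.1 hx)).2
      exact ⟨⟨_, hfG⟩, ⟨h.symm, subset_insert _ _⟩, rfl⟩
    · intro x hx y hy h
      have hnot : ∀ z ∈ ({x | SameColour c e (insert x I)} : Finset V), z ∉ I := by
        intro z hz hzI
        have h1 := (mem_filter.1 hz).2.symm.card_eq
        rw [insert_eq_of_mem hzI, hI] at h1
        omega
      have hxy : x ∈ insert y I := by
        have h' : insert x I = insert y I := h
        rw [← h']
        exact mem_insert_self _ _
      exact (mem_insert.1 hxy).resolve_right (hnot x hx)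
  · have : ({x | SameColour c e (insert x I)} : Finset V) = ∅ := by
      rw [filter_eq_empty_iff]
      rintro f - ⟨h, -⟩
      exact he h
    rw [this]
    simp only [card_empty, Nat.cast_zero]
    positivity

end SameColour

open Finset in
/-- Factors in the blocks of a partition of the vertex set form a rainbow factor, if there are no
two edges of the same colour inside a block or in different blocks. -/
theorem exists_rainbow_factor_of_blocks {r q : ℕ} {U : Type u} {V : Type v} [Fintype U]
    [Fintype V] [DecidableEq V] {H : RGraph r U} {G : RGraph r V} {C : Type w}
    {c : {e : Finset V // e ∈ G.edges} → C} (hU : 0 < Fintype.card U) (S : Fin q → Finset V)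
    (hS : ∀ i j, i ≠ j → Disjoint (S i) (S j)) (hcard : ∑ i, #(S i) = Fintype.card V)
    (hF : ∀ i, ∃ F : Finset (Copy H G), IsPartialFactor F ∧ (∀ K ∈ F, K.verts ⊆ S i) ∧
      #F * Fintype.card U = #(S i))
    (hin : ∀ i, ConflictFree (SameColour c) (S i))
    (hout : ∀ i j, i ≠ j → ∀ e ⊆ S i, ∀ f ⊆ S j, ¬ SameColour c e f) :
    ∃ F : Finset (Copy H G), IsFactor F ∧ IsRainbow c F := by
  classical
  choose F hFp hFS hFc using hF
  have hdisj : ∀ i j, i ≠ j → ∀ K ∈ F i, ∀ K' ∈ F j, Disjoint K.verts K'.verts :=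
    fun i j hij K hK K' hK' => (hS i j hij).mono (hFS i K hK) (hFS j K' hK')
  refine ⟨univ.biUnion F, ⟨?_, ?_⟩, ?_⟩
  · intro K hK K' hK' hne
    obtain ⟨i, -, hKi⟩ := mem_biUnion.1 (mem_coe.1 hK)
    obtain ⟨j, -, hKj⟩ := mem_biUnion.1 (mem_coe.1 hK')
    by_cases hij : i = j
    · subst hij
      exact hFp i hKi hKj hne
    · exact hdisj i j hij K hKi K' hKj
  · rw [card_biUnion, sum_mul, ← hcard]
    · exact sum_congr rfl fun i _ => hFc i
    · intro i _ j _ hij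
      rw [Function.onFun, disjoint_left]
      intro K hK hK'
      have h1 := hdisj i j hij K hK K hK'
      rw [disjoint_self, bot_eq_empty] at h1
      have h2 := K.card_verts
      rw [h1, card_empty] at h2
      omega
  · rintro ⟨e, he⟩ ⟨K, hK, heK⟩ ⟨f, hf⟩ ⟨K', hK', hfK⟩ hcol
    obtain ⟨i, -, hKi⟩ := mem_biUnion.1 hK
    obtain ⟨j, -, hKj⟩ := mem_biUnion.1 hK'
    have heS : e ⊆ S i := (K.subset_verts heK).trans (hFS i K hKi)
    have hfS : f ⊆ S j := (K'.subset_verts hfK).trans (hFS j K' hKj)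
    have hsame : SameColour c e f := ⟨he, hf, hcol⟩
    by_cases hij : i = j
    · subst hij
      exact Subtype.ext (hin i e heS f hfS hsame)
    · exact absurd hsame (hout i j hij e heS f hfS)

open Finset in
open scoped Classical in
/-- The rainbow statement for a single `H`. A block size `M = m h` is chosen along which the
threshold is nearly attained; the blocks have `M` or `M + h` vertices, so that they partition any
large multiple of `h`. -/
theorem exists_rainbow_factor {h r ℓ : ℕ} (hℓr : ℓ < r) (hh : 0 < h) (H : RGraph r (Fin h))
    {ε : ℝ} (hε : 0 < ε) (hε1 : ε < 1) :
    ∃ μ₀ : ℝ, 0 < μ₀ ∧ ∃ n₀ : ℕ, ∀ μ : ℝ, 0 < μ → μ < μ₀ → ∀ n : ℕ, n₀ ≤ n → h ∣ n →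
      ∀ G : RGraph r (Fin n),
        (H.factorThreshold ℓ + ε) * (n : ℝ) ^ (r - ℓ) ≤ (G.minDegree ℓ : ℝ) →
        ∀ (C : Type w) (c : {e : Finset (Fin n) // e ∈ G.edges} → C), G.IsBounded c μ →
          ∃ F : Finset (Copy H G), IsFactor F ∧ IsRainbow c F := by
  obtain ⟨k, hr⟩ : ∃ k, ℓ + k = r := ⟨r - ℓ, by omega⟩
  have hk : 0 < k := by omega
  have hrk : r - ℓ = k := by omega
  set δ := H.factorThreshold ℓ with hδ
  have hδ0 : 0 ≤ δ := factorThreshold_nonneg ℓ H hℓr.le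
  set c₀ : ℝ := (ε / 4) ^ 2 / (4 * k ^ 2) with hc₀
  have hc₀pos : 0 < c₀ := by
    have : (0 : ℝ) < k := by exact_mod_cast hk
    positivity
  -- the block sizes `M = m h` and `M + h`
  have hev := (eventually_degree_bound ℓ k hδ0 hε).and
    ((eventually_pow_mul_exp_neg_le ℓ hc₀pos (show (0 : ℝ) < 1 / 64 by norm_num)).and
    ((eventually_ge_atTop (r + h + ℓ + 2)).and
      (eventually_gt_atTop ⌈4 * (h * 2 ^ (k - 1)) / ε⌉₊)))
  rw [eventually_atTop] at hev
  obtain ⟨b₀, hb₀⟩ := hev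
  have hfreq := frequently_exists_factor (H := H) hℓr.le
    (show H.factorThreshold ℓ < δ + ε / 4 by linarith)
  rw [Fintype.card_fin] at hfreq
  obtain ⟨m, hm, hfac⟩ := (frequently_atTop.1 hfreq) (b₀ + 1)
  rw [hrk] at hfac
  set M := m * h with hM
  have hb₀M : b₀ ≤ M := by
    have : m * 1 ≤ m * h := Nat.mul_le_mul_left _ hh
    omega
  have hMbig := (hb₀ M hb₀M).2.2.1
  have hMceil := (hb₀ M hb₀M).2.2.2
  have hMpos : (0 : ℝ) < M := by
    have : 0 < M := by omega
    exact_mod_cast this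
  set B := 2 * M with hB
  -- `A μ` bounds the contribution of the conflicts between edges of the same colour
  set A : ℝ := 4 ^ B + 2 * r ^ (r + 1) * B ^ (2 * r) with hA
  have hApos : 0 < A := by positivity
  obtain ⟨n₁, hn₁⟩ := eventually_atTop.1 (eventually_pow_le_two_mul_descFactorial B)
  refine ⟨1 / (64 * M * A), by positivity, max n₁ (m * m * h), ?_⟩
  intro μ hμ hμ₀ n hn hhn G hG C c hc
  rw [lt_div_iff₀ (by positivity)] at hμ₀
  obtain ⟨q, sz, hszM, hsz⟩ := exists_block_sizes (show 0 < m by omega) hh hhn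
    ((le_max_right _ _).trans hn)
  rw [← hM] at hszM
  have hMsz : ∀ i, M ≤ sz i := fun i => by rcases hszM i with h | h <;> omega
  have hszB : ∀ i, sz i ≤ B := fun i => by rcases hszM i with h | h <;> omega
  have hdeg : ∀ L : Finset (Fin n), #L = ℓ →
      (δ + ε) * (Fintype.card (Fin n) : ℝ) ^ k ≤ G.degree L := by
    intro L hL
    rw [hrk] at hG
    rw [Fintype.card_fin]
    refine hG.trans ?_
    have : G.minDegree ℓ ≤ G.degree L := Nat.sInf_le ⟨L, hL, rfl⟩
    exact_mod_cast this
  let D' : ℕ → ℝ := fun b => (δ + ε / 2) * (b : ℝ) ^ k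
  obtain ⟨Bad, hBad⟩ : ∃ Bad : ∀ i, (Fin (sz i) → Fin n) → Prop, ∀ i τ, Bad i τ ↔
      Function.Injective τ ∧ (¬ G.HasMinDegreeOn ℓ (D' (sz i)) (univ.image τ) ∨
        ¬ ConflictFree (SameColour c) (univ.image τ)) := ⟨_, fun _ _ => Iff.rfl⟩
  have hη : ∀ i p v, (#{τ : Fin (sz i) → Fin n | τ p = v ∧ Bad i τ} : ℝ) ≤
      (1 / (64 * M) + 4 ^ B * μ) * (Fintype.card (Fin n) : ℝ) ^ (sz i - 1) := by
    intro i p v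
    obtain ⟨hb1, hb2, hb3, -⟩ := hb₀ (sz i) (hb₀M.trans (hMsz i))
    have h1 := card_low_degree_le G hr hk (b := sz i) (by omega) (α := δ + ε) (ε := ε / 4)
      (D := D' (sz i)) (by linarith) (by linarith) hdeg hb1 p v
    have h2 := card_conflict_le (R := SameColour c) hμ.le (fun e f h => h.symm)
      (fun e f h => h.card_eq) (fun e I hI => by
        have := card_sameColour_insert_le hμ.le (by omega) hc e I hI
        convert this) p v
    have hsub : ({τ : Fin (sz i) → Fin n | τ p = v ∧ Bad i τ} : Finset _) ⊆
        ({τ : Fin (sz i) → Fin n | τ p = v ∧ Function.Injective τ ∧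
          ¬ G.HasMinDegreeOn ℓ (D' (sz i)) (univ.image τ)} : Finset _) ∪
        ({τ : Fin (sz i) → Fin n | τ p = v ∧ Function.Injective τ ∧
          ¬ ConflictFree (SameColour c) (univ.image τ)} : Finset _) := by
      intro τ hτ
      obtain ⟨hv, hbad⟩ := (mem_filter.1 hτ).2
      obtain ⟨hinj, hor⟩ := (hBad i τ).1 hbad
      rcases hor with hor | hor
      · exact mem_union_left _ (mem_filter.2 ⟨mem_univ _, hv, hinj, hor⟩)
      · exact mem_union_right _ (mem_filter.2 ⟨mem_univ _, hv, hinj, hor⟩)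
    have h3 := Nat.cast_le (α := ℝ).2 ((card_le_card hsub).trans (card_union_le _ _))
    rw [Nat.cast_add] at h3
    refine h3.trans ((add_le_add h1 h2).trans ?_)
    rw [← add_mul]
    refine mul_le_mul_of_nonneg_right (add_le_add ?_ ?_) (by positivity)
    · have hszpos : (M : ℝ) ≤ sz i := by exact_mod_cast hMsz i
      have h4 : 0 ≤ (sz i : ℝ) ^ ℓ * Real.exp (-(c₀ * (sz i - ℓ - 1 : ℝ))) := by positivity
      have h5 : (sz i : ℝ) ^ (ℓ + 1) * Real.exp (-(c₀ * (sz i - ℓ - 1 : ℝ))) =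
          (sz i : ℝ) ^ ℓ * Real.exp (-(c₀ * (sz i - ℓ - 1 : ℝ))) * sz i := by ring
      rw [le_div_iff₀ (by positivity)]
      have h6 := mul_le_mul_of_nonneg_left hszpos h4
      linarith
    · gcongr
      · norm_num
      · exact hszB i
  have hnn : ∀ d ≤ B, (Fintype.card (Fin n) : ℝ) ^ d ≤
      2 * (Fintype.card (Fin n)).descFactorial d := by
    rw [Fintype.card_fin]
    exact hn₁ n ((le_max_left _ _).trans hn)
  have hRdeg : ∀ e, (#{f | SameColour c e f} : ℝ) ≤
      μ * (Fintype.card (Fin n) : ℝ) ^ (r - 1) := fun e => by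
    have := card_sameColour_le hμ.le hc e
    convert this
  have hsmall : 16 * (B : ℝ) * (1 / (64 * M) + 4 ^ B * μ + 2 * r ^ (r + 1) * B ^ (2 * r) * μ) ≤
      1 := by
    have h1 : 16 * (B : ℝ) * (1 / (64 * M) + 4 ^ B * μ + 2 * r ^ (r + 1) * B ^ (2 * r) * μ) =
        1 / 2 + 32 * M * (A * μ) := by
      rw [hA, hB]
      push_cast
      field_simp
      ring
    rw [h1]
    linarith
  have hszpos : ∀ i, 0 < sz i := fun i => by have := hMsz i; omega
  have hrB : 2 * r ≤ B := by omega
  have hr0 : 0 < r := by omega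
  have hszn : ∑ i, sz i = Fintype.card (Fin n) := by rw [hsz, Fintype.card_fin]
  obtain ⟨σ, hσ, hσ'⟩ := exists_good_blocks hr0 sz hszn hszpos hszB hrB Bad hη
    (SameColour c) (fun e f h => h.symm) (fun e f h => h.card_eq) hRdeg hnn hsmall
  have hinj : ∀ i, Function.Injective fun s => σ ⟨i, s⟩ := fun i s s' h =>
    eq_of_heq (Sigma.mk.inj (σ.injective h)).2
  have hScard : ∀ i, #(univ.image fun s => σ ⟨i, s⟩) = sz i := fun i => by
    rw [card_image_of_injective _ (hinj i), card_univ, Fintype.card_fin]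
  have hgood : ∀ i, G.HasMinDegreeOn ℓ (D' (sz i)) (univ.image fun s => σ ⟨i, s⟩) ∧
      ConflictFree (SameColour c) (univ.image fun s => σ ⟨i, s⟩) := by
    intro i
    by_contra hcon
    exact hσ i ((hBad i _).2 ⟨hinj i, not_and_or.1 hcon⟩)
  have hDD' : ∀ i, (δ + ε / 4) * (M : ℝ) ^ k +
      Fintype.card (Fin h) * ((M + Fintype.card (Fin h) : ℕ) : ℝ) ^ (k - 1) < D' (sz i) := by
    intro i
    rw [Fintype.card_fin]
    have h1 : (M : ℝ) ≤ sz i := by exact_mod_cast hMsz i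
    have h2 : (δ + ε / 2) * (M : ℝ) ^ k ≤ D' (sz i) := by
      simp only [D']
      gcongr
    have h3 : ((M + h : ℕ) : ℝ) ^ (k - 1) ≤ (2 * M) ^ (k - 1) := by
      gcongr
      have : M + h ≤ 2 * M := by omega
      exact_mod_cast this
    have h4 : 4 * (h * 2 ^ (k - 1)) / ε < M := Nat.lt_of_ceil_lt hMceil
    rw [div_lt_iff₀ hε] at h4
    have h5 : (M : ℝ) ^ k = M * (M : ℝ) ^ (k - 1) := by
      rw [← pow_succ']
      congr 1
      omega
    have h6 : (0 : ℝ) < (M : ℝ) ^ (k - 1) := by positivity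
    have h7 := mul_lt_mul_of_pos_right h4 h6
    have h8 : (h : ℝ) * ((M + h : ℕ) : ℝ) ^ (k - 1) ≤ h * (2 ^ (k - 1) * (M : ℝ) ^ (k - 1)) := by
      rw [← mul_pow]
      gcongr
    have h9 : (M : ℝ) * ε * (M : ℝ) ^ (k - 1) = ε * (M : ℝ) ^ k := by rw [h5]; ring
    linarith
  refine exists_rainbow_factor_of_blocks (by rwa [Fintype.card_fin])
    (fun i => univ.image fun s => σ ⟨i, s⟩) ?_ ?_ ?_ (fun i => (hgood i).2) hσ'
  · intro i j hij
    rw [disjoint_left]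
    intro x hx hx'
    obtain ⟨s, -, rfl⟩ := mem_image.1 hx
    obtain ⟨s', -, hs⟩ := mem_image.1 hx'
    exact hij (congrArg Sigma.fst (σ.injective hs)).symm
  · exact (sum_congr rfl fun i _ => hScard i).trans hszn
  · intro i
    refine exists_factor_inside_of_card hr (by omega) (by rwa [Fintype.card_fin]) (by omega) hfac
      (hDD' i) ?_ (hgood i).1
    rw [hScard, Fintype.card_fin]
    exact hszM i

end RGraph

theorem theorem1 (h r ℓ : ℕ) (hℓ : 1 ≤ ℓ) (hℓr : ℓ < r) (hrh : r ≤ h) :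
    -- the degree condition for `H`-factors, with an error `ε`, gives rainbow `H`-factors
    (∃ ε₀ : ℝ, 0 < ε₀ ∧ ∀ ε : ℝ, 0 < ε → ε < ε₀ →
      ∃ μ₀ : ℝ, 0 < μ₀ ∧ ∀ μ : ℝ, 0 < μ → μ < μ₀ →
      ∃ n₀ : ℕ, ∀ n : ℕ, n₀ ≤ n → h ∣ n →
        ∀ (H : RGraph r (Fin h)) (G : RGraph r (Fin n)),
          (H.factorThreshold ℓ + ε) * (n : ℝ) ^ (r - ℓ) ≤ (G.minDegree ℓ : ℝ) →
          ∀ (C : Type u) (c : {e : Finset (Fin n) // e ∈ G.edges} → C),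
            G.IsBounded c μ →
            ∃ F : Finset (RGraph.Copy H G), RGraph.IsFactor F ∧ RGraph.IsRainbow c F) ∧
    -- and below the threshold for `H`-factors there need not be any rainbow `H`-factor
    (∀ (H : RGraph r (Fin h)) (δ μ : ℝ), 0 ≤ δ → δ < H.factorThreshold ℓ → 0 < μ →
      ∃ n₀ : ℕ, ∀ n : ℕ, n₀ ≤ n → h ∣ n →
        ∃ (G : RGraph r (Fin n)) (c : {e : Finset (Fin n) // e ∈ G.edges} → ℕ),
          δ * (n : ℝ) ^ (r - ℓ) ≤ (G.minDegree ℓ : ℝ) ∧ G.IsBounded c μ ∧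
          ¬ ∃ F : Finset (RGraph.Copy H G), RGraph.IsFactor F ∧ RGraph.IsRainbow c F) := by
  constructor
  · refine ⟨1, one_pos, fun ε hε hε1 => ?_⟩
    have hfin : Finite (RGraph r (Fin h)) :=
      Finite.of_injective RGraph.edges fun ⟨E, _⟩ ⟨E', _⟩ h => by cases h; rfl
    have hne : Nonempty (RGraph r (Fin h)) := ⟨⟨∅, by simp⟩⟩
    choose μ₀ hμ₀ n₀ hn₀ using fun H : RGraph r (Fin h) =>
      RGraph.exists_rainbow_factor.{u} hℓr (show 0 < h by omega) H hε hε1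
    -- there are finitely many `H`, so `μ₀` and `n₀` can be chosen for all of them
    obtain ⟨H₁, hH₁⟩ := Finite.exists_min μ₀
    obtain ⟨H₂, hH₂⟩ := Finite.exists_max n₀
    exact ⟨μ₀ H₁, hμ₀ H₁, fun μ hμ hμlt => ⟨n₀ H₂, fun n hn hhn H G hG C c hc =>
      hn₀ H μ hμ (hμlt.trans_le (hH₁ H)) n ((hH₂ H).trans hn) hhn G hG C c hc⟩⟩
  · intro H δ μ hδ hδlt hμ
    have hev := RGraph.eventually_exists_no_factor hδ hδlt
    rw [Fintype.card_fin] at hev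
    obtain ⟨m₀, hm₀⟩ := eventually_atTop.1 hev
    refine ⟨max (m₀ * h) (⌈1 / μ⌉₊ + 1), fun n hn hhn => ?_⟩
    obtain ⟨m, rfl⟩ := hhn
    rw [mul_comm h m] at hn ⊢
    have hm : m₀ ≤ m := Nat.le_of_mul_le_mul_right ((le_max_left _ _).trans hn) (by omega)
    obtain ⟨G, hG, hno⟩ := hm₀ m hm
    have hn1 := (le_max_right _ _).trans hn
    -- `G` has no `H`-factor at all, so any bounded colouring will do
    obtain ⟨c, hc⟩ := exists_injective_nat {e : Finset (Fin (m * h)) // e ∈ G.edges}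
    refine ⟨G, c, hG.le, ?_, fun ⟨F, hF, _⟩ => hno ⟨F, hF⟩⟩
    have hμn : 1 ≤ μ * ((m * h : ℕ) : ℝ) := by
      have h1 : 1 / μ ≤ ((m * h : ℕ) : ℝ) := Nat.ceil_le.1 (by omega)
      rwa [div_le_iff₀' hμ] at h1
    intro k
    rw [Fintype.card_fin]
    constructor
    · have h1 : {e | c e = k}.ncard ≤ 1 :=
        (Set.ncard_le_one_iff (Set.toFinite _)).2 fun {a b} ha hb => hc (ha.trans hb.symm)
      have h2 : ((m * h : ℕ) : ℝ) ≤ ((m * h : ℕ) : ℝ) ^ (r - 1) :=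
        le_self_pow₀ (by exact_mod_cast (by omega : 1 ≤ m * h)) (by omega)
      have h3 := mul_le_mul_of_nonneg_left h2 hμ.le
      have h4 : ({e | c e = k}.ncard : ℝ) ≤ 1 := by exact_mod_cast h1
      linarith
    · intro I _
      have h1 : {e | c e = k ∧ I ⊆ e.1}.ncard ≤ 1 :=
        (Set.ncard_le_one_iff (Set.toFinite _)).2 fun {a b} ha hb => hc (ha.1.trans hb.1.symm)
      have h4 : ({e | c e = k ∧ I ⊆ e.1}.ncard : ℝ) ≤ 1 := by exact_mod_cast h1
      linarith
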